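/- A \emph{shape} $\alpha$ consists of a finite set $\mathcal V(\alpha)$ of vertices, each of which is a circle or a square; two tuples $U_\alpha$, $V_\alpha$ of distinct vertices (which may intersect), circles listed before squares; and a finite set $E(\alpha)$ of edges, each joining a circle and a square and carrying an integer label $l_e\ge 1$. It is \emph{proper} if no two edges have the same endpoints. Write $|E(\alpha)|=\sum_e l_e$, and write $U_{\alpha,\circ},U_{\alpha,\Box}$ for the tuples of circles and of squares of $U_\alpha$ (likewise for $V_\alpha$). Let $h_j=H_j/\sqrt{j!}$ be the normalized Hermite polynomials, $\exp(tz-t^2/2)=\sum_j H_j(z)t^j/j!$. For an array $(v_{i,k})_{i\in[n],k\in[d]}$ of reals, the \emph{graph matrix} $M_\alpha$ has rows indexed by pairs $A=(A_\circ,A_\Box)$, where $A_\circ$ is a tuple of $|U_{\alpha,\circ}|$ distinct elements of $[n]$ and $A_\Box$ a tuple of $|U_{\alpha,\Box}|$ distinct elements of $[d]$, columns indexed likewise by pairs $B$ for $V_\alpha$, and entries \[ M_\alpha(A,B)=\sum_{\pi,\sigma}\ \prod_{e=\{u,x\}\in E(\alpha),\ u\text{ circle},\ x\text{ square}} h_{l_e}\bigl(v_{\pi(u),\sigma(x)}\bigr),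 \] where $\pi$ (from the circles to $[n]$) and $\sigma$ (from the squares to $[d]$) range over injective maps with $\pi(U_{\alpha,\circ})=A_\circ$, $\sigma(U_{\alpha,\Box})=A_\Box$, $\pi(V_{\alpha,\circ})=B_\circ$, $\sigma(V_{\alpha,\Box})=B_\Box$. Let $\varphi(a)=1$ for a circle $a$, $\varphi(a)=\log_n d$ for a square $a$, and $\varphi(S)=\sum_{a\in S}\varphi(a)$ for $S\subseteq\mathcal V(\alpha)$. A \emph{min-vertex separator} $S_{\min}$ of $\alpha$ is a set of vertices of minimum weight $\varphi$ (possibly empty) among those that meet every path, including paths of length $0$, from $U_\alpha$ to $V_\alpha$. Let $\mathrm{Iso}(\alpha)$ be the set of isolated vertices of $\alpha$ outside $U_\alpha\cup V_\alpha$. \textbf{Theorem.} Let $n\ge 2$ and $1\le d\le n$ be integers, and let $v_{i,k}$ ($i\in[n]$, $k\in[d]$) be independent standard Gaussian random variables. Let $D_V,D_E$ be integers with $D_E\ge D_V\ge 2$ and let $\epsilon>0$. With probability at least $1-\epsilon$, the following holds simultaneously for all proper shapes $\alpha$ with $|\mathcal V(\alpha)|\le D_V$, $|E(\alpha)|\le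 D_E$, $|U_\alpha|\le 1$, $|V_\alpha|\le 1$, and every min-vertex separator $S_{\min}$ of $\alpha$: \[ \|M_\alpha\|_{op}\le\Bigl((2D_E+2)\ln D_V+\ln(11n)+\ln\tfrac1\epsilon\Bigr)^{|\mathcal V(\alpha)|+|E(\alpha)|}\; n^{\frac{\varphi(\mathcal V(\alpha))-\varphi(S_{\min})+\varphi(\mathrm{Iso}(\alpha))}{2}} . \] -/

import Mathlib

open MeasureTheory ProbabilityTheory

noncomputable section

/-- The normalized (probabilists') Hermite polynomial `h_j = H_j / √(j!)`, as a function. -/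
def hermiteNormalized (j : ℕ) (z : ℝ) : ℝ :=
  Polynomial.aeval z (Polynomial.hermite j) / Real.sqrt (j.factorial : ℝ)

/-- A shape. Its vertices are the circles `Fin circles` and the squares `Fin squares`.
The tuples `U` (left) and `V` (right) list their circle vertices first, then their square
vertices, without repetition. An element `(u, x, l)` of the multiset `edges` is an edge between
the circle `u` and the square `x` with label `l`. -/
structure Shape where
  circles : ℕ
  squares : ℕ
  leftCircles : ℕ
  leftSquares : ℕ
  rightCircles : ℕ
  rightSquares : ℕ
  leftC : Fin leftCircles ↪ Fin circles
  leftS : Fin leftSquares ↪ Fin squares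
  rightC : Fin rightCircles ↪ Fin circles
  rightS : Fin rightSquares ↪ Fin squares
  edges : Multiset (Fin circles × Fin squares × ℕ)
  label_pos : ∀ e ∈ edges, 1 ≤ e.2.2

namespace Shape

/-- The vertex set of the shape. -/
abbrev Vertex (α : Shape) : Type := Fin α.circles ⊕ Fin α.squares

/-- A shape is proper if no two of its edges have the same endpoints. -/
def IsProper (α : Shape) : Prop := (α.edges.map fun e => (e.1, e.2.1)).Nodup

/-- The number of vertices. -/
def numVertices (α : Shape) : ℕ := α.circles + α.squares

/-- `|E(α)|`, the sum of the edge labels. -/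
def totalLabel (α : Shape) : ℕ := (α.edges.map fun e => e.2.2).sum

/-- `|U_α|`. -/
def leftSize (α : Shape) : ℕ := α.leftCircles + α.leftSquares

/-- `|V_α|`. -/
def rightSize (α : Shape) : ℕ := α.rightCircles + α.rightSquares

/-- `U_α` as a set of vertices. -/
def leftSet (α : Shape) : Set α.Vertex :=
  Sum.inl '' Set.range α.leftC ∪ Sum.inr '' Set.range α.leftS

/-- `V_α` as a set of vertices. -/
def rightSet (α : Shape) : Set α.Vertex :=
  Sum.inl '' Set.range α.rightC ∪ Sum.inr '' Set.range α.rightS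

/-- The underlying (bipartite) graph on the vertices, forgetting labels and multiplicities. -/
def graph (α : Shape) : SimpleGraph α.Vertex :=
  SimpleGraph.fromRel fun a b =>
    ∃ e ∈ α.edges, a = Sum.inl e.1 ∧ b = Sum.inr e.2.1

/-- Row indices: tuples of distinct elements of `[n]` and of `[d]`, of the lengths of the circle
and the square part of `U_α`. -/
abbrev RowIndex (α : Shape) (n d : ℕ) : Type :=
  (Fin α.leftCircles ↪ Fin n) × (Fin α.leftSquares ↪ Fin d)

/-- Column indices, likewise for `V_α`. -/
abbrev ColIndex (α : Shape) (n d : ℕ) : Type :=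
  (Fin α.rightCircles ↪ Fin n) × (Fin α.rightSquares ↪ Fin d)

open scoped Classical in
/-- The graph matrix `M_α` of the array `v`. -/
def graphMatrix (α : Shape) {n d : ℕ} (v : Fin n → Fin d → ℝ) :
    Matrix (α.RowIndex n d) (α.ColIndex n d) ℝ :=
  Matrix.of fun A B =>
    ∑ π : Fin α.circles ↪ Fin n, ∑ σ : Fin α.squares ↪ Fin d,
      if α.leftC.trans π = A.1 ∧ α.leftS.trans σ = A.2 ∧
          α.rightC.trans π = B.1 ∧ α.rightS.trans σ = B.2 then
        (α.edges.map fun e => hermiteNormalized e.2.2 (v (π e.1) (σ e.2.1))).prod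
      else 0

/-- The weight of a vertex: `1` for a circle, `log_n d` for a square. -/
def vertexWeight (α : Shape) (n d : ℕ) : α.Vertex → ℝ :=
  Sum.elim (fun _ => 1) (fun _ => Real.logb n d)

/-- The weight `φ(S)` of a set of vertices. -/
def weight (α : Shape) (n d : ℕ) (S : Finset α.Vertex) : ℝ :=
  ∑ a ∈ S, α.vertexWeight n d a

/-- `S` meets every path, possibly of length `0`, from `U_α` to `V_α`. -/
def IsSeparator (α : Shape) (S : Finset α.Vertex) : Prop :=
  ∀ a ∈ α.leftSet, ∀ b ∈ α.rightSet, ∀ p : α.graph.Walk a b, p.IsPath → ∃ w ∈ p.support, w ∈ S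

/-- `S` is a vertex separator of minimum weight. -/
def IsMinSeparator (α : Shape) (n d : ℕ) (S : Finset α.Vertex) : Prop :=
  α.IsSeparator S ∧ ∀ T : Finset α.Vertex, α.IsSeparator T → α.weight n d S ≤ α.weight n d T

open scoped Classical in
/-- The isolated vertices outside `U_α ∪ V_α`. -/
def iso (α : Shape) : Finset α.Vertex :=
  {a | a ∉ α.leftSet ∧ a ∉ α.rightSet ∧ ∀ b, ¬ α.graph.Adj a b}

end Shape

open scoped Classical Matrix.Norms.L2Operator in
/-- The `ℓ² → ℓ²` operator norm of a real matrix. -/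
def matrixOpNorm {m k : Type} [Fintype m] [Fintype k] (M : Matrix m k ℝ) : ℝ := ‖M‖

end

/-! ### Gaussian moments of products of Hermite polynomials -/

section GaussianHermite
open Polynomial

/-! The proof is the trace method with a union bound over shapes. For a fixed shape with at least
one edge and `m = 2 * (q + 1)`, Markov's inequality is applied to `tr (M Mᵀ) ^ (q + 1)`, which
dominates the `m`-th power of the operator norm. The trace is a sum over closed walks of `m`
labelled copies of the shape, consecutive copies agreeing on `U` or on `V`.

Three facts control its expectation. Gaussian integration by parts shows that a moment of `m`
Hermite factors in one variable lies between `0` and `(m - 1)` to half the total degree, and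
vanishes if only one factor is nonconstant (`hermiteMoment_bounds`, `hermiteMoment_eq_zero`). Hence
in a walk that contributes, each edge of each copy is repeated in another copy. For such a walk, the
vertices of a copy whose labels occur both earlier and later separate `U` from `V`; charging each
label to its first and to its last occurrence, an average copy accounts for new labels of weight at
most half of `φ(active) - φ(S_min)` (`two_mul_sum_values_le`). Only the row labels of the first copy
are exempt, of weight at most `1` because `|U| ≤ 1`; this costs one factor `n`. Finally, walks are
counted with weight `n⁻¹` or `d⁻¹` per distinct label, which leaves factorials
(`sum_inv_pow_card_image_fin_le`). Isolated vertices are free in each copy, so their weight enters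
undivided.

Let `L` be the base of the power in the theorem. Choosing `m` with `m * |active|` between `L / 2`
and `L` makes the failure probability of one shape at most `n * exp (-L)` (`moment_numeric_bound`).
Edgeless shapes satisfy the bound deterministically by the Schur test. There are at most `11 * DV ^
(2 * DE + 2)` shapes to consider, and `L` is the number for which the union bound equals `ε`. -/

theorem integrable_eval_gaussianReal (p : ℝ[X]) :
    Integrable (fun x => p.eval x) (gaussianReal 0 1) := by
  induction p using Polynomial.induction_on' with
  | add p q hp hq => exact (hp.add hq).congr (ae_of_all _ fun x => by simp)
  | monomial k a =>
    simp only [eval_monomial]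
    refine Integrable.const_mul ?_ a
    have h := (memLp_id_gaussianReal (μ := 0) (v := 1) k).integrable_norm_pow'
    refine (integrable_norm_iff (by fun_prop)).1 (h.congr (ae_of_all _ fun x => ?_))
    simp

/-- Gaussian integration by parts for polynomials. -/
theorem integral_mul_eval_gaussianReal (p : ℝ[X]) :
    ∫ x, x * p.eval x ∂gaussianReal 0 1 = ∫ x, p.derivative.eval x ∂gaussianReal 0 1 := by
  have hint : ∀ q : ℝ[X], Integrable (fun x => q.eval x * gaussianPDFReal 0 1 x) := by
    intro q
    have h := integrable_eval_gaussianReal q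
    rw [gaussianReal_of_var_ne_zero 0 one_ne_zero,
      integrable_withDensity_iff_integrable_smul' (measurable_gaussianPDF 0 1)
        (ae_of_all _ fun x => gaussianPDF_lt_top)] at h
    refine h.congr (ae_of_all _ fun x => ?_)
    simp [toReal_gaussianPDF, mul_comm]
  have hderiv : ∀ x, HasDerivAt (gaussianPDFReal 0 1) (-(x * gaussianPDFReal 0 1 x)) x := by
    intro x
    have h1 : HasDerivAt (fun x : ℝ => -x ^ 2 / 2) (-x) x := by
      have h := (hasDerivAt_pow 2 x).neg.div_const 2
      have e : -(((2 : ℕ) : ℝ) * x ^ (2 - 1)) / 2 = -x := by push_cast; ring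
      rwa [e] at h
    have h2 := (h1.exp).const_mul (√(2 * Real.pi))⁻¹
    have e1 : gaussianPDFReal 0 1 = fun y => (√(2 * Real.pi))⁻¹ * Real.exp (-y ^ 2 / 2) := by
      funext y; simp [gaussianPDFReal]
    have e2 : -(x * gaussianPDFReal 0 1 x) =
        (√(2 * Real.pi))⁻¹ * (Real.exp (-x ^ 2 / 2) * -x) := by
      rw [e1]; ring
    rw [e2, e1]; exact h2
  have key := integral_mul_deriv_eq_deriv_mul_of_integrable
    (u := fun x => p.eval x) (v := gaussianPDFReal 0 1)
    (u' := fun x => p.derivative.eval x) (v' := fun x => -(x * gaussianPDFReal 0 1 x))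
    (fun x _ => p.hasDerivAt x) (fun x _ => hderiv x)
    (by
      refine (hint (X * p)).neg.congr (ae_of_all _ fun x => ?_)
      simp; ring)
    (hint _) (hint _)
  rw [integral_gaussianReal_eq_integral_smul one_ne_zero,
    integral_gaussianReal_eq_integral_smul one_ne_zero]
  have e1 : ∫ x, gaussianPDFReal 0 1 x • (x * p.eval x)
      = - ∫ x, p.eval x * -(x * gaussianPDFReal 0 1 x) := by
    rw [← integral_neg]; congr 1; funext x; simp; ring
  rw [e1, key, neg_neg]
  congr 1; funext x; simp [mul_comm]

theorem derivative_hermite_succ (j : ℕ) :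
    derivative (hermite (j + 1)) = ((j + 1 : ℕ) : ℤ[X]) * hermite j := by
  induction j with
  | zero => simp
  | succ j ih =>
    rw [hermite_succ (j + 1), derivative_sub, derivative_mul, derivative_X, one_mul, ih,
      derivative_mul, derivative_natCast, hermite_succ j]
    push_cast
    ring

/-- The normalized Hermite polynomial. -/
noncomputable def hermitePoly (j : ℕ) : ℝ[X] :=
  C ((√(j.factorial : ℝ))⁻¹) * (hermite j).map (Int.castRingHom ℝ)

theorem eval_hermitePoly (j : ℕ) (x : ℝ) : (hermitePoly j).eval x = hermiteNormalized j x := by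
  simp only [hermitePoly, hermiteNormalized, eval_mul, eval_C, eval_map, div_eq_inv_mul]
  rfl

theorem hermitePoly_zero : hermitePoly 0 = 1 := by simp [hermitePoly]

theorem sqrt_factorial_succ (j : ℕ) :
    √((j + 1).factorial : ℝ) = √((j : ℝ) + 1) * √(j.factorial : ℝ) := by
  rw [Nat.factorial_succ, ← Real.sqrt_mul (by positivity)]; push_cast; rfl

theorem derivative_hermitePoly (j : ℕ) :
    derivative (hermitePoly j) = C (√(j : ℝ)) * hermitePoly (j - 1) := by
  rcases j with _ | j
  · simp [hermitePoly]
  · have h1 : √((j : ℝ) + 1) ≠ 0 := by positivity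
    have h2 : √(j.factorial : ℝ) ≠ 0 := by positivity
    have h3 : √((j : ℝ) + 1) * √((j : ℝ) + 1) = (j : ℝ) + 1 := Real.mul_self_sqrt (by positivity)
    have key : (√((j + 1).factorial : ℝ))⁻¹ * ((j : ℝ) + 1) =
        √((j : ℝ) + 1) * (√(j.factorial : ℝ))⁻¹ := by
      rw [sqrt_factorial_succ]; field_simp; rw [sq, h3]
    simp only [hermitePoly, derivative_mul, derivative_C, zero_mul, zero_add, derivative_map,
      derivative_hermite_succ, Polynomial.map_mul, Polynomial.map_natCast, Nat.add_sub_cancel]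
    rw [← mul_assoc, ← mul_assoc, ← C_mul]
    push_cast
    rw [← key, C_mul]
    simp

/-- Up to the factor `√(j + 1)`, the next Hermite polynomial arises by applying `x - d/dx`, and
integration by parts makes this operator the adjoint of `d/dx` under the Gaussian law. -/
theorem integral_hermitePoly_succ_mul (j : ℕ) (p : ℝ[X]) :
    ∫ x, (hermitePoly (j + 1) * p).eval x ∂gaussianReal 0 1 =
      (√((j : ℝ) + 1))⁻¹ * ∫ x, (hermitePoly j * derivative p).eval x ∂gaussianReal 0 1 := by
  have hrec : hermitePoly (j + 1) * p = C (√((j : ℝ) + 1))⁻¹ *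
      (X * (hermitePoly j * p) - derivative (hermitePoly j) * p) := by
    simp only [hermitePoly, sqrt_factorial_succ, hermite_succ, Polynomial.map_sub,
      Polynomial.map_mul, map_X, mul_inv, C_mul, derivative_mul, derivative_C, derivative_map]
    ring
  have h2 := integral_mul_eval_gaussianReal (hermitePoly j * p)
  rw [hrec]
  simp only [eval_mul, eval_C, eval_sub, eval_X] at h2 ⊢
  rw [integral_const_mul, integral_sub, h2, ← integral_sub]
  · congr 2; funext x; simp
  · exact integrable_eval_gaussianReal _
  · simpa using integrable_eval_gaussianReal (derivative (hermitePoly j) * p)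
  · exact (integrable_eval_gaussianReal (X * (hermitePoly j * p))).congr
      (ae_of_all _ fun x => by simp)
  · simpa using integrable_eval_gaussianReal (derivative (hermitePoly j) * p)

variable {ι : Type*} [Fintype ι]

/-- The expectation of a product of normalized Hermite polynomials of one Gaussian variable. -/
noncomputable def hermiteMoment (l : ι → ℕ) : ℝ :=
  ∫ x, ∏ i, hermiteNormalized (l i) x ∂gaussianReal 0 1

theorem hermiteMoment_eq (l : ι → ℕ) :
    hermiteMoment l = ∫ x, (∏ i, hermitePoly (l i)).eval x ∂gaussianReal 0 1 := by
  simp only [hermiteMoment, eval_prod, eval_hermitePoly]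

variable [DecidableEq ι]

/-- One degree is taken from factor `i` by adjointness, and the Leibniz rule differentiates one of
the other factors. If `l j = 0`, the truncated `l j - 1` is harmless because the coefficient `√(l
j)` vanishes. -/
theorem hermiteMoment_recurrence (l : ι → ℕ) (i : ι) (hi : 0 < l i) :
    hermiteMoment l = ∑ j ∈ Finset.univ.erase i, (√(l i : ℝ))⁻¹ * √(l j : ℝ) *
      hermiteMoment (Function.update (Function.update l i (l i - 1)) j (l j - 1)) := by
  obtain ⟨k, hk⟩ : ∃ k, l i = k + 1 := ⟨l i - 1, by omega⟩
  rw [hermiteMoment_eq, ← Finset.mul_prod_erase _ _ (Finset.mem_univ i), hk,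
    integral_hermitePoly_succ_mul, derivative_prod_finset, Finset.mul_sum]
  simp only [eval_finsetSum]
  rw [integral_finsetSum _ fun j _ => integrable_eval_gaussianReal _, Finset.mul_sum]
  refine Finset.sum_congr rfl fun j hj => ?_
  have hji : j ≠ i := Finset.ne_of_mem_erase hj
  rw [mul_assoc, hermiteMoment_eq]
  push_cast
  congr 1
  rw [← integral_const_mul]
  congr 1; funext x
  rw [derivative_hermitePoly, ← Finset.mul_prod_erase _ _ (Finset.mem_univ i),
    ← Finset.mul_prod_erase _ _ hj]
  have hprod : ∏ a ∈ (Finset.univ.erase i).erase j, hermitePoly (l a) =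
      ∏ a ∈ (Finset.univ.erase i).erase j,
        hermitePoly (Function.update (Function.update l i (k + 1 - 1)) j (l j - 1) a) := by
    refine Finset.prod_congr rfl fun a ha => ?_
    rw [Function.update_of_ne (Finset.ne_of_mem_erase ha),
      Function.update_of_ne (Finset.ne_of_mem_erase (Finset.mem_of_mem_erase ha))]
  rw [hprod]
  simp only [Function.update_self, Function.update_of_ne hji.symm, eval_mul, eval_C,
    Nat.add_sub_cancel]
  ring

theorem sum_update_update_pred (l : ι → ℕ) {i j : ι} (hij : j ≠ i) (hi : 0 < l i)
    (hj : 0 < l j) :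
    ∑ a, Function.update (Function.update l i (l i - 1)) j (l j - 1) a + 2 = ∑ a, l a := by
  rw [← Finset.add_sum_erase _ _ (Finset.mem_univ j),
    ← Finset.add_sum_erase _ l (Finset.mem_univ j)]
  have hi' : i ∈ Finset.univ.erase j := by simp [hij.symm]
  rw [← Finset.add_sum_erase _ _ hi', ← Finset.add_sum_erase _ l hi']
  have : ∑ a ∈ (Finset.univ.erase j).erase i,
      Function.update (Function.update l i (l i - 1)) j (l j - 1) a =
      ∑ a ∈ (Finset.univ.erase j).erase i, l a := by
    refine Finset.sum_congr rfl fun a ha => ?_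
    rw [Function.update_of_ne (Finset.ne_of_mem_erase (Finset.mem_of_mem_erase ha)),
      Function.update_of_ne (Finset.ne_of_mem_erase ha)]
  rw [this]
  simp only [Function.update_self, Function.update_of_ne hij.symm]
  omega

/-- Induction on the total degree. Each use of the recurrence lowers the degree by two and produces
at most `card ι - 1` nonzero terms, hence one factor `√(card ι - 1)` per degree. -/
theorem hermiteMoment_bounds (l : ι → ℕ) :
    0 ≤ hermiteMoment l ∧
      hermiteMoment l ≤ √((Fintype.card ι : ℝ) - 1) ^ (∑ i, l i) := by
  induction hs : ∑ i, l i using Nat.strong_induction_on generalizing l with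
  | _ s ih =>
    by_cases h0 : ∀ i, l i = 0
    · have hl : hermiteMoment l = 1 := by simp [hermiteMoment_eq, h0, hermitePoly_zero]
      have : s = 0 := by simp [← hs, h0]
      simp [hl, this]
    · push Not at h0
      obtain ⟨i₀, hi₀⟩ := h0
      -- Removing a degree from the factor of largest degree keeps all coefficients `√(l j / l i)`
      -- at most `1`.
      obtain ⟨i, -, hmax⟩ := Finset.exists_max_image Finset.univ l ⟨i₀, Finset.mem_univ _⟩
      have hi : 0 < l i := lt_of_lt_of_le (Nat.pos_of_ne_zero hi₀) (hmax _ (Finset.mem_univ _))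
      have hcard : (1 : ℝ) ≤ Fintype.card ι := by
        exact_mod_cast Fintype.card_pos_iff.2 ⟨i⟩
      have hterm : ∀ j ∈ Finset.univ.erase i, 0 ≤ (√(l i : ℝ))⁻¹ * √(l j : ℝ) *
          hermiteMoment (Function.update (Function.update l i (l i - 1)) j (l j - 1)) ∧
          (√(l i : ℝ))⁻¹ * √(l j : ℝ) *
          hermiteMoment (Function.update (Function.update l i (l i - 1)) j (l j - 1)) ≤
          √((Fintype.card ι : ℝ) - 1) ^ (s - 2) := by
        intro j hj
        rcases Nat.eq_zero_or_pos (l j) with hj0 | hj0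
        · rw [hj0]; simp
        · have hsum := sum_update_update_pred l (Finset.ne_of_mem_erase hj) hi hj0
          obtain ⟨h1, h2⟩ := ih (s - 2) (by omega)
            (Function.update (Function.update l i (l i - 1)) j (l j - 1)) (by omega)
          refine ⟨by positivity, le_trans (mul_le_of_le_one_left h1 ?_) h2⟩
          rw [inv_mul_le_iff₀ (by positivity), mul_one]
          exact Real.sqrt_le_sqrt (by exact_mod_cast hmax j (Finset.mem_univ _))
      rw [hermiteMoment_recurrence l i hi]
      refine ⟨Finset.sum_nonneg fun j hj => (hterm j hj).1, ?_⟩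
      -- A second positive label guarantees `s ≥ 2`, so that `s - 2` is not truncated; without one
      -- the whole sum is zero.
      by_cases hex : ∃ j ∈ Finset.univ.erase i, 0 < l j
      · obtain ⟨j, hj, hj0⟩ := hex
        have hs2 := sum_update_update_pred l (Finset.ne_of_mem_erase hj) hi hj0
        refine (Finset.sum_le_card_nsmul _ _ _ fun j hj => (hterm j hj).2).trans (le_of_eq ?_)
        obtain ⟨r, hr⟩ : ∃ r, s = r + 2 := ⟨s - 2, by omega⟩
        rw [hr, pow_add, Real.sq_sqrt (by linarith), Finset.card_erase_of_mem (Finset.mem_univ _),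
          Finset.card_univ, nsmul_eq_mul, Nat.cast_sub (by exact_mod_cast hcard)]
        push_cast
        simp [mul_comm]
      · push Not at hex
        rw [Finset.sum_eq_zero]
        · positivity
        · intro j hj
          rw [Nat.le_zero.1 (hex j hj)]; simp

theorem hermiteMoment_eq_zero (l : ι → ℕ) (i : ι) (hi : l i ≠ 0) (h : ∀ j, j ≠ i → l j = 0) :
    hermiteMoment l = 0 := by
  rw [hermiteMoment_recurrence l i (Nat.pos_of_ne_zero hi)]
  refine Finset.sum_eq_zero fun j hj => ?_
  rw [h j (Finset.ne_of_mem_erase hj)]; simp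

end GaussianHermite

/-! ### Operator norms: the trace method and the Schur test -/

section OperatorNorm
open scoped Matrix.Norms.L2Operator

theorem norm_pow_le_trace_pow {κ : Type*} [Fintype κ] [DecidableEq κ] {B : Matrix κ κ ℝ}
    (hB : B.PosSemidef) (q : ℕ) (hq : q ≠ 0) : ‖B‖ ^ q ≤ (B ^ q).trace := by
  have hH := hB.isHermitian
  set u := hH.eigenvectorUnitary with hu
  have hspec := hH.spectral_theorem
  rw [Unitary.conjStarAlgAut_apply] at hspec
  have hnorm : ‖B‖ ≤ ‖hH.eigenvalues‖ := by
    conv_lhs => rw [hspec]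
    rw [CStarRing.norm_mul_mem_unitary _ (Unitary.star_mem u.2), CStarRing.norm_coe_unitary_mul]
    exact (Matrix.l2_opNorm_diagonal _).le
  have htr : (B ^ q).trace = ∑ i, hH.eigenvalues i ^ q := by
    conv_lhs => rw [hH.spectral_theorem, ← map_pow, Unitary.conjStarAlgAut_apply,
      Matrix.trace_mul_comm, ← mul_assoc, Unitary.coe_star_mul_self, one_mul,
      Matrix.diagonal_pow, Matrix.trace_diagonal]
    rfl
  rw [htr]
  have hnn : ∀ i, 0 ≤ hH.eigenvalues i := hB.eigenvalues_nonneg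
  have hS : 0 ≤ ∑ i, hH.eigenvalues i ^ q := Finset.sum_nonneg fun i _ => pow_nonneg (hnn i) q
  have hle : ‖hH.eigenvalues‖ ≤ (∑ i, hH.eigenvalues i ^ q) ^ ((q : ℝ)⁻¹) := by
    refine (pi_norm_le_iff_of_nonneg (by positivity)).2 fun i => ?_
    rw [Real.norm_of_nonneg (hnn i), ← Real.pow_rpow_inv_natCast (hnn i) hq]
    gcongr
    · exact pow_nonneg (hnn i) q
    · exact Finset.single_le_sum (f := fun i => hH.eigenvalues i ^ q)
        (fun i _ => pow_nonneg (hnn i) q) (Finset.mem_univ i)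
  calc ‖B‖ ^ q ≤ ((∑ i, hH.eigenvalues i ^ q) ^ ((q : ℝ)⁻¹)) ^ q := by
        gcongr; exact hnorm.trans hle
    _ = _ := Real.rpow_inv_natCast_pow hS hq

theorem matrixOpNorm_pow_le_trace {m k : Type} [Fintype m] [Fintype k] [DecidableEq m]
    (M : Matrix m k ℝ) (q : ℕ) (hq : q ≠ 0) :
    matrixOpNorm M ^ (2 * q) ≤ ((M * M.transpose) ^ q).trace := by
  classical
  have h1 : matrixOpNorm M ^ 2 = ‖M * M.transpose‖ := by
    have h := Matrix.l2_opNorm_conjTranspose_mul_self M.conjTranspose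
    rw [Matrix.conjTranspose_conjTranspose, Matrix.l2_opNorm_conjTranspose] at h
    rw [sq]
    unfold matrixOpNorm
    rw [Matrix.conjTranspose_eq_transpose_of_trivial] at h
    exact h.symm
  rw [pow_mul, h1]
  exact norm_pow_le_trace_pow (by simpa using Matrix.posSemidef_self_mul_conjTranspose M) q hq

/-- The Schur test for a nonnegative matrix. -/
theorem matrixOpNorm_sq_le_of_row_col {m k : Type} [Fintype m] [Fintype k]
    (M : Matrix m k ℝ) (hM : ∀ i j, 0 ≤ M i j) {R C : ℝ} (hR0 : 0 ≤ R) (hC0 : 0 ≤ C)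
    (hR : ∀ i, ∑ j, M i j ≤ R) (hC : ∀ j, ∑ i, M i j ≤ C) : matrixOpNorm M ^ 2 ≤ R * C := by
  classical
  have h : matrixOpNorm M ≤ √(R * C) := by
    unfold matrixOpNorm
    rw [Matrix.l2_opNorm_def]
    refine ContinuousLinearMap.opNorm_le_bound _ (Real.sqrt_nonneg _) fun x => ?_
    rw [EuclideanSpace.norm_eq, EuclideanSpace.norm_eq, ← Real.sqrt_mul (by positivity)]
    refine Real.sqrt_le_sqrt ?_
    simp only [Real.norm_eq_abs, sq_abs]
    -- Cauchy–Schwarz with the weights `M i j`, which are nonnegative.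
    have hrow : ∀ i, (∑ j, M i j * x j) ^ 2 ≤ R * ∑ j, M i j * x j ^ 2 := by
      intro i
      have := Finset.sum_sq_le_sum_mul_sum_of_sq_le_mul Finset.univ (fun j _ => hM i j)
        (fun j _ => mul_nonneg (hM i j) (sq_nonneg (x j)))
        (r := fun j => M i j * x j) (fun j _ => le_of_eq (by ring))
      exact this.trans (mul_le_mul_of_nonneg_right (hR i)
        (Finset.sum_nonneg fun j _ => mul_nonneg (hM i j) (sq_nonneg _)))
    calc _ = ∑ i, (∑ j, M i j * x j) ^ 2 := by
          simp [Matrix.mulVec, dotProduct]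
      _ ≤ ∑ i, R * ∑ j, M i j * x j ^ 2 := Finset.sum_le_sum fun i _ => hrow i
      _ = R * ∑ j, (∑ i, M i j) * x j ^ 2 := by
          rw [← Finset.mul_sum, Finset.sum_comm]
          simp only [Finset.sum_mul]
      _ ≤ R * ∑ j, C * x j ^ 2 := by
          gcongr with j
          exact hC j
      _ = R * C * ∑ j, x j ^ 2 := by rw [← Finset.mul_sum]; ring
  calc matrixOpNorm M ^ 2 ≤ √(R * C) ^ 2 := by
        gcongr; unfold matrixOpNorm; positivity
    _ = R * C := Real.sq_sqrt (by positivity)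

end OperatorNorm

/-! ### Matrix powers as sums over walks -/

section PathExpansion
variable {κ β : Type*}

/-- The arcs `p 0, …, p (q - 1)`, with sources `s` and targets `t`, form a walk from `a` to `b`. -/
def IsArcWalk (s t : β → κ) {q : ℕ} (a b : κ) (p : Fin q → β) : Prop :=
  ∃ z : Fin (q + 1) → κ, z 0 = a ∧ z (Fin.last q) = b ∧
    ∀ i, s (p i) = z i.castSucc ∧ t (p i) = z i.succ

theorem isArcWalk_cons (s t : β → κ) {q : ℕ} (a b : κ) (x : β) (p : Fin q → β) :
    IsArcWalk s t a b (Fin.cons x p : Fin (q + 1) → β) ↔ s x = a ∧ IsArcWalk s t (t x) b p := by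
  constructor
  · rintro ⟨z, h0, h1, h⟩
    have hx := h 0
    simp only [Fin.cons_zero, Fin.castSucc_zero] at hx
    refine ⟨hx.1.trans h0, fun i => z i.succ, hx.2.symm, by simpa using h1, fun i => ?_⟩
    simpa using h i.succ
  · rintro ⟨hx, z, h0, h1, h⟩
    refine ⟨Fin.cons a z, rfl, ?_, fun i => ?_⟩
    · rw [← Fin.succ_last, Fin.cons_succ, h1]
    · refine Fin.cases ?_ (fun i => ?_) i
      · simp [hx, h0]
      · simpa using h i

open Classical in
/-- Powers of a matrix whose entries are sums over labelled arcs, as sums over walks. -/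
theorem pow_apply_eq_sum_arcWalk [Fintype κ] [DecidableEq κ] [Fintype β] (s t : β → κ) (Y : β → ℝ)
    (q : ℕ) (a b : κ) :
    ((Matrix.of fun a b => ∑ p, if s p = a ∧ t p = b then Y p else 0) ^ q : Matrix κ κ ℝ) a b =
      ∑ p : Fin q → β, if IsArcWalk s t a b p then ∏ i, Y (p i) else 0 := by
  induction q generalizing a with
  | zero =>
    simp only [pow_zero, Matrix.one_apply, Finset.univ_unique, Finset.sum_singleton,
      Finset.univ_eq_empty, Finset.prod_empty]
    congr 1
    refine propext ⟨fun h => ⟨fun _ => a, rfl, h, fun i => i.elim0⟩, ?_⟩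
    rintro ⟨z, h0, h1, -⟩
    rw [← h0, ← h1]; rfl
  | succ q ih =>
    rw [pow_succ', Matrix.mul_apply]
    simp only [ih]
    rw [← (Fin.consEquiv fun _ => β).sum_comp, Fintype.sum_prod_type]
    simp only [Matrix.of_apply, Finset.sum_mul]
    rw [Finset.sum_comm]
    refine Finset.sum_congr rfl fun x _ => ?_
    rw [Finset.sum_eq_single (t x) (fun c _ hc => by rw [if_neg (fun h => hc h.2.symm), zero_mul])
      (by simp)]
    rw [Finset.mul_sum]
    refine Finset.sum_congr rfl fun p _ => ?_
    have hc : (Fin.consEquiv fun _ => β) (x, p) = (Fin.cons x p : Fin (q + 1) → β) := rfl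
    rw [hc]
    simp only [isArcWalk_cons, Fin.prod_univ_succ, Fin.cons_zero, Fin.cons_succ, and_true]
    by_cases h1 : s x = a <;> by_cases h2 : IsArcWalk s t (t x) b p <;> simp [h1, h2]

end PathExpansion

/-! ### Repeated labels and vertex separators -/

section OccurrencePatterns

variable {T Vert Val : Type*}

/-- At time `t`, the value of the vertex `a` lies in `base` or has occurred before, on a vertex
in `W`. -/
def OccursBefore (τ : T → ℤ) (Ψ : T → Vert → Val) (W : Finset Vert) (base : Finset Val) (t : T)
    (a : Vert) : Prop :=
  Ψ t a ∈ base ∨ ∃ t', τ t' < τ t ∧ ∃ a' ∈ W, Ψ t' a' = Ψ t a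

/-- A discrete intermediate value argument. If a vertex occurs before but not after time `t`, then
the other copy of the next edge must be earlier, so the next vertex also occurs before. Along the
walk this persists until some vertex also occurs after, which the endpoint `b` does. -/
theorem exists_mem_support_occursBefore_and_after {τ : T → ℤ} {Ψ : T → Vert → Val}
    {W : Finset Vert} {base : Finset Val} {G : SimpleGraph Vert} (hτ : Function.Injective τ) {t : T}
    (hedge : ∀ a b, G.Adj a b →
      ∃ t', t' ≠ t ∧ (∃ a' ∈ W, Ψ t' a' = Ψ t a) ∧ ∃ b' ∈ W, Ψ t' b' = Ψ t b)
    {a b : Vert} (p : G.Walk a b) (ha : OccursBefore τ Ψ W base t a)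
    (hb : OccursBefore (-τ) Ψ W base t b) :
    ∃ w ∈ p.support, OccursBefore τ Ψ W base t w ∧ OccursBefore (-τ) Ψ W base t w := by
  induction p with
  | nil => exact ⟨_, by simp, ha, hb⟩
  | @cons a c b hac p ih =>
    by_cases hl : OccursBefore (-τ) Ψ W base t a
    · exact ⟨a, by simp, ha, hl⟩
    · obtain ⟨t', ht', ⟨a', ha'W, ha'⟩, c', hc'W, hc'⟩ := hedge a c hac
      have hlt : τ t' < τ t := by
        refine lt_of_le_of_ne (not_lt.1 fun h => hl (Or.inr ⟨t', ?_, a', ha'W, ha'⟩))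
          fun h => ht' (hτ h)
        simpa using h
      obtain ⟨w, hw, h⟩ := ih (Or.inr ⟨t', hlt, c', hc'W, hc'⟩) hb
      exact ⟨w, by simp [hw], h⟩

variable [Fintype T] [DecidableEq Val]

-- Each value outside `base` is charged to the slot of its earliest occurrence; injectivity of `Ψ t`
-- makes that slot unique. Applied to `-τ`, the same statement charges last occurrences.
open Classical in
theorem sum_first_occurrences {τ : T → ℤ} (hτ : Function.Injective τ) {Ψ : T → Vert → Val}
    (hΨ : ∀ t, Function.Injective (Ψ t)) (W : Finset Vert) (base : Finset Val) (φ : Val → ℝ) :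
    ∑ x ∈ (Finset.univ ×ˢ W).image (fun z : T × Vert => Ψ z.1 z.2) \ base, φ x =
      ∑ t, ∑ a ∈ W, if OccursBefore τ Ψ W base t a then 0 else φ (Ψ t a) := by
  rw [← Finset.sum_product', ← Finset.sum_filter_add_sum_filter_not _
    (fun z : T × Vert => OccursBefore τ Ψ W base z.1 z.2)]
  rw [Finset.sum_eq_zero (fun z hz => if_pos (Finset.mem_filter.1 hz).2), zero_add,
    Finset.sum_congr rfl (fun z hz => if_neg (Finset.mem_filter.1 hz).2),
    ← Finset.sum_image (f := φ) (g := fun z : T × Vert => Ψ z.1 z.2)]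
  · refine Finset.sum_congr (Finset.ext fun x => ?_) fun _ _ => rfl
    simp only [Finset.mem_sdiff, Finset.mem_image, Finset.mem_product, Finset.mem_univ, true_and,
      Finset.mem_filter, Prod.exists]
    constructor
    · rintro ⟨⟨t₀, a₀, ha₀, rfl⟩, hb⟩
      obtain ⟨t, ht, hmin⟩ := Finset.exists_min_image
        (Finset.univ.filter fun t => ∃ a ∈ W, Ψ t a = Ψ t₀ a₀) τ ⟨t₀, by simpa using ⟨a₀, ha₀, rfl⟩⟩
      obtain ⟨a, haW, ha⟩ := (Finset.mem_filter.1 ht).2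
      refine ⟨t, a, ⟨haW, ?_⟩, ha⟩
      rintro (h | ⟨t', ht', a', ha'W, ha'⟩)
      · exact hb (ha ▸ h)
      · exact absurd (hmin t' (by simpa using ⟨a', ha'W, ha'.trans ha⟩)) (not_le.2 ht')
    · rintro ⟨t, a, ⟨haW, ha⟩, rfl⟩
      exact ⟨⟨t, a, haW, rfl⟩, fun h => ha (Or.inl h)⟩
  · rintro ⟨t, a⟩ h₁ ⟨t', a'⟩ h₂ heq
    simp only [Finset.coe_filter, Finset.mem_product, Finset.mem_univ, true_and,
      Set.mem_ofPred_eq] at h₁ h₂ heq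
    have htt : t = t' := by
      rcases lt_trichotomy (τ t) (τ t') with h | h | h
      · exact absurd (Or.inr ⟨t, h, a, h₁.1, heq⟩) h₂.2
      · exact hτ h
      · exact absurd (Or.inr ⟨t', h, a', h₂.1, heq.symm⟩) h₁.2
    subst htt
    rw [hΨ t heq]

open Classical in
/-- The weight of the values that occur is at most half of the weight of the slots, the
separators of weight at least `σ` excepted. -/
theorem two_mul_sum_values_le {τ : T → ℤ} (hτ : Function.Injective τ) {Ψ : T → Vert → Val}
    (hΨ : ∀ t, Function.Injective (Ψ t)) (W : Finset Vert) (base : Finset Val) (G : SimpleGraph Vert)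
    (left right : Set Vert) (hleft : ∀ a ∈ left, a ∈ W)
    (hadj : ∀ a b, G.Adj a b → a ∈ W)
    (hW : ∀ a ∈ W, a ∈ left ∨ a ∈ right ∨ ∃ b, G.Adj a b)
    (hedge : ∀ t a b, G.Adj a b →
      ∃ t', t' ≠ t ∧ (∃ a' ∈ W, Ψ t' a' = Ψ t a) ∧ ∃ b' ∈ W, Ψ t' b' = Ψ t b)
    (hbd : ∀ t, ((∀ a ∈ left, OccursBefore τ Ψ W base t a) ∧
        ∀ b ∈ right, OccursBefore (-τ) Ψ W base t b) ∨
      ((∀ a ∈ left, OccursBefore (-τ) Ψ W base t a) ∧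
        ∀ b ∈ right, OccursBefore τ Ψ W base t b))
    (φ : Vert → ℝ) (φ' : Val → ℝ) (hφ' : ∀ t a, φ' (Ψ t a) = φ a) (s : ℝ)
    (hs : ∀ N : Finset Vert, (∀ a ∈ left, ∀ b ∈ right, ∀ p : G.Walk a b, ∃ w ∈ p.support, w ∈ N) →
      s ≤ ∑ a ∈ N, φ a) :
    2 * ∑ x ∈ (Finset.univ ×ˢ W).image (fun z : T × Vert => Ψ z.1 z.2) \ base, φ' x ≤
      Fintype.card T * (∑ a ∈ W, φ a - s) := by
  have hnτ : Function.Injective (-τ) := fun x y h => hτ (by simpa using h)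
  -- At each time the vertices that occur both before and after form a separator, so their weight is
  -- at least `s`.
  have hN : ∀ t, s ≤ ∑ a ∈ W.filter
      (fun a => OccursBefore τ Ψ W base t a ∧ OccursBefore (-τ) Ψ W base t a), φ a := by
    intro t
    refine hs _ fun a ha b hb p => ?_
    have hsupp : ∀ w ∈ p.support, w ∈ W := by
      intro w hw
      by_cases hp : p.Nil
      · have : w = a := by
          rw [SimpleGraph.Walk.nil_iff_support_eq.1 hp] at hw; simpa using hw
        exact this ▸ hleft a ha
      · obtain ⟨c, hc⟩ := SimpleGraph.adj_of_mem_walk_support p hp hw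
        exact hadj _ _ hc.2
    have hex : ∃ w ∈ p.support, OccursBefore τ Ψ W base t w ∧ OccursBefore (-τ) Ψ W base t w := by
      -- Copies of the transpose have the roles of `left` and `right` exchanged; there the walk is
      -- traversed backwards.
      rcases hbd t with ⟨h1, h2⟩ | ⟨h1, h2⟩
      · exact exists_mem_support_occursBefore_and_after hτ (hedge t) p (h1 a ha) (h2 b hb)
      · obtain ⟨w, hw, h3, h4⟩ := exists_mem_support_occursBefore_and_after hτ (hedge t) p.reverse
          (h2 b hb) (h1 a ha)
        exact ⟨w, by simpa using hw, h3, h4⟩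
    obtain ⟨w, hw, h⟩ := hex
    exact ⟨w, hw, Finset.mem_filter.2 ⟨hsupp w hw, h⟩⟩
  have hone : ∀ t, ∀ a ∈ W, OccursBefore τ Ψ W base t a ∨ OccursBefore (-τ) Ψ W base t a := by
    intro t a ha
    rcases hW a ha with h | h | ⟨b, h⟩
    · rcases hbd t with h' | h'
      · exact Or.inl (h'.1 a h)
      · exact Or.inr (h'.1 a h)
    · rcases hbd t with h' | h'
      · exact Or.inr (h'.2 a h)
      · exact Or.inl (h'.2 a h)
    · obtain ⟨t', ht', ⟨a', ha'W, ha'⟩, -⟩ := hedge t a b h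
      rcases lt_or_gt_of_ne (fun h => ht' (hτ h)) with h | h
      · exact Or.inl (Or.inr ⟨t', h, a', ha'W, ha'⟩)
      · exact Or.inr (Or.inr ⟨t', by simpa using h, a', ha'W, ha'⟩)
  -- By `hone`, no vertex is both a first and a last occurrence. A vertex in the separator is
  -- neither, so first and last occurrences together miss weight at least `s`.
  have hslot : ∀ t, (∑ a ∈ W, if OccursBefore τ Ψ W base t a then 0 else φ' (Ψ t a)) +
      (∑ a ∈ W, if OccursBefore (-τ) Ψ W base t a then 0 else φ' (Ψ t a)) ≤
      ∑ a ∈ W, φ a - s := by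
    intro t
    have h := hN t
    rw [Finset.sum_filter] at h
    have : (∑ a ∈ W, if OccursBefore τ Ψ W base t a then 0 else φ' (Ψ t a)) +
      (∑ a ∈ W, if OccursBefore (-τ) Ψ W base t a then 0 else φ' (Ψ t a)) +
      (∑ a ∈ W, if OccursBefore τ Ψ W base t a ∧ OccursBefore (-τ) Ψ W base t a then φ a else 0) =
      ∑ a ∈ W, φ a := by
      rw [← Finset.sum_add_distrib, ← Finset.sum_add_distrib]
      refine Finset.sum_congr rfl fun a ha => ?_
      rw [hφ']
      rcases hone t a ha with h | h <;> by_cases h' : OccursBefore τ Ψ W base t a <;>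
        by_cases h'' : OccursBefore (-τ) Ψ W base t a <;> simp_all
    linarith
  calc _ = (∑ t, ∑ a ∈ W, if OccursBefore τ Ψ W base t a then 0 else φ' (Ψ t a)) +
      (∑ t, ∑ a ∈ W, if OccursBefore (-τ) Ψ W base t a then 0 else φ' (Ψ t a)) := by
        rw [← sum_first_occurrences hτ hΨ, ← sum_first_occurrences hnτ hΨ, two_mul]
    _ ≤ ∑ _t : T, (∑ a ∈ W, φ a - s) := by
        rw [← Finset.sum_add_distrib]
        exact Finset.sum_le_sum fun t _ => hslot t
    _ = _ := by rw [Finset.sum_const, nsmul_eq_mul, Finset.card_univ]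

end OccurrencePatterns

/-! ### Counting functions weighted by the size of their image -/

section CountingFunctions

/-- Adding one coordinate to `k` others multiplies the sum by at most `k + 1`: at most `k` choices
repeat an old value, and the at most `n` new values cost a factor `n⁻¹` each. -/
theorem sum_inv_pow_card_image_fin_le {n : ℕ} (k : ℕ) :
    ∑ f : Fin k → Fin n, ((n : ℝ)⁻¹) ^ (Finset.univ.image f).card ≤ k.factorial := by
  classical
  rcases Nat.eq_zero_or_pos n with rfl | hn
  · rcases k with _ | k
    · simp
    · simp
  induction k with
  | zero => simp
  | succ k ih =>
    have hn0 : (n : ℝ) ≠ 0 := by positivity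
    rw [← (Fin.consEquiv fun _ => Fin n).sum_comp, Fintype.sum_prod_type, Finset.sum_comm]
    have hstep : ∀ f : Fin k → Fin n, ∑ x : Fin n, ((n : ℝ)⁻¹) ^
        (Finset.univ.image ((Fin.consEquiv fun _ => Fin n) (x, f))).card ≤
        (k + 1) * ((n : ℝ)⁻¹) ^ (Finset.univ.image f).card := by
      intro f
      have himg : ∀ x, Finset.univ.image ((Fin.consEquiv fun _ => Fin n) (x, f)) =
          insert x (Finset.univ.image f) := by
        intro x; ext y
        simp [Fin.consEquiv, Fin.exists_fin_succ, eq_comm]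
      have hterm : ∀ x, ((n : ℝ)⁻¹) ^
          (Finset.univ.image ((Fin.consEquiv fun _ => Fin n) (x, f))).card ≤
          (if x ∈ Finset.univ.image f then ((n : ℝ)⁻¹) ^ (Finset.univ.image f).card else 0) +
            (n : ℝ)⁻¹ * ((n : ℝ)⁻¹) ^ (Finset.univ.image f).card := by
        intro x
        rw [himg]
        split_ifs with hx
        · rw [Finset.insert_eq_of_mem hx]
          have : (0 : ℝ) ≤ (n : ℝ)⁻¹ * ((n : ℝ)⁻¹) ^ (Finset.univ.image f).card := by positivity
          linarith
        · rw [Finset.card_insert_of_notMem hx, pow_succ, mul_comm, zero_add]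
      refine (Finset.sum_le_sum fun x _ => hterm x).trans ?_
      rw [Finset.sum_add_distrib, Finset.sum_const, Finset.card_univ, Fintype.card_fin,
        nsmul_eq_mul, ← mul_assoc, mul_inv_cancel₀ hn0, one_mul, ← Finset.sum_filter,
        Finset.sum_const, nsmul_eq_mul, add_mul, one_mul]
      gcongr
      rw [Finset.filter_mem_eq_inter, Finset.univ_inter]
      simpa using Finset.card_image_le (s := Finset.univ) (f := f)
    refine (Finset.sum_le_sum fun f _ => hstep f).trans ?_
    rw [← Finset.mul_sum, Nat.factorial_succ]
    push_cast
    gcongr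

theorem sum_inv_pow_card_image_le {K : Type*} [Fintype K] [DecidableEq K] {n : ℕ} :
    ∑ f : K → Fin n, ((n : ℝ)⁻¹) ^ (Finset.univ.image f).card ≤ (Fintype.card K).factorial := by
  classical
  refine le_trans (le_of_eq ?_) (sum_inv_pow_card_image_fin_le (n := n) (Fintype.card K))
  rw [← (Equiv.arrowCongr (Fintype.equivFin K) (Equiv.refl (Fin n))).sum_comp]
  refine Finset.sum_congr rfl fun f _ => ?_
  congr 2
  ext x
  simp only [Finset.mem_image, Finset.mem_univ, true_and, Equiv.arrowCongr_apply,
    Equiv.coe_refl, Function.comp, id]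
  constructor
  · rintro ⟨a, rfl⟩; exact ⟨Fintype.equivFin K a, by simp⟩
  · rintro ⟨a, rfl⟩; exact ⟨_, rfl⟩

theorem sum_inv_pow_card_image_subset_le {K : Type*} [Fintype K] [DecidableEq K] {n : ℕ}
    (W : Finset K) :
    ∑ f : K → Fin n, ((n : ℝ)⁻¹) ^ (W.image f).card ≤
      (n : ℝ) ^ (Wᶜ.card) * (W.card).factorial := by
  classical
  rw [← (Equiv.piEquivPiSubtypeProd (fun k => k ∈ W) fun _ => Fin n).symm.sum_comp,
    Fintype.sum_prod_type]
  have himg : ∀ (g : {k // k ∈ W} → Fin n) (g' : {k // k ∉ W} → Fin n),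
      W.image ((Equiv.piEquivPiSubtypeProd (fun k => k ∈ W) fun _ => Fin n).symm (g, g')) =
        Finset.univ.image g := by
    intro g g'; ext x
    simp only [Finset.mem_image, Equiv.piEquivPiSubtypeProd_symm_apply, Finset.mem_univ, true_and,
      Subtype.exists]
    constructor
    · rintro ⟨a, ha, rfl⟩; exact ⟨a, ha, by simp [ha]⟩
    · rintro ⟨a, ha, rfl⟩; exact ⟨a, ha, by simp [ha]⟩
  simp only [himg, Finset.sum_const, nsmul_eq_mul, ← Finset.mul_sum]
  refine mul_le_mul (le_of_eq ?_) ?_ (by positivity) (by positivity)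
  · rw [Finset.card_univ, Fintype.card_fun, Fintype.card_fin, Fintype.card_subtype_compl]
    push_cast
    rw [Finset.card_compl]
    simp
  · simpa using sum_inv_pow_card_image_le (K := {k // k ∈ W}) (n := n)

end CountingFunctions

namespace Shape

/-! ### Edge labels of a proper shape as a function on pairs of vertices -/

section Labels
variable (α : Shape)

/-- The label of the edge with given endpoints, and `0` if there is none. -/
def edgeLabel (p : Fin α.circles × Fin α.squares) : ℕ :=
  (α.edges.map fun e => if (e.1, e.2.1) = p then e.2.2 else 0).sum

theorem edgeLabel_of_mem {α : Shape} (hα : α.IsProper) {e : Fin α.circles × Fin α.squares × ℕ}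
    (he : e ∈ α.edges) : α.edgeLabel (e.1, e.2.1) = e.2.2 := by
  obtain ⟨t, ht⟩ := Multiset.exists_cons_of_mem he
  have hnd := hα
  rw [IsProper, ht, Multiset.map_cons, Multiset.nodup_cons] at hnd
  rw [edgeLabel, ht, Multiset.map_cons, Multiset.sum_cons, if_pos rfl, Multiset.sum_eq_zero,
    add_zero]
  intro x hx
  obtain ⟨e', he', rfl⟩ := Multiset.mem_map.1 hx
  rw [if_neg fun h => hnd.1 (Multiset.mem_map.2 ⟨e', he', h⟩)]

theorem edgeLabel_ne_zero_iff (p : Fin α.circles × Fin α.squares) :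
    α.edgeLabel p ≠ 0 ↔ ∃ e ∈ α.edges, (e.1, e.2.1) = p := by
  constructor
  · intro h
    by_contra! hne
    exact h (Multiset.sum_eq_zero fun x hx => by
      obtain ⟨e, he, rfl⟩ := Multiset.mem_map.1 hx
      exact if_neg (hne e he))
  · rintro ⟨e, he, hp⟩ h0
    have := Multiset.single_le_sum (fun x _ => Nat.zero_le x) _ (Multiset.mem_map_of_mem
      (fun e : Fin α.circles × Fin α.squares × ℕ => if (e.1, e.2.1) = p then e.2.2 else 0) he)
    rw [if_pos hp] at this
    have h1 := α.label_pos e he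
    rw [edgeLabel] at h0
    omega

theorem map_endpoints_eq {α : Shape} (hα : α.IsProper) :
    α.edges.map (fun e => (e.1, e.2.1)) = (Finset.univ.filter fun p => α.edgeLabel p ≠ 0).val := by
  refine (Multiset.Nodup.ext hα (Finset.nodup _)).2 fun p => ?_
  simp only [Multiset.mem_map, Finset.mem_val, Finset.mem_filter, Finset.mem_univ, true_and,
    edgeLabel_ne_zero_iff]

/-- Properness makes `edgeLabel` the label of a single edge. Pairs without an edge have label `0`
and contribute `1`, so the product may run over all pairs. -/
theorem prod_map_edges {α : Shape} (hα : α.IsProper) (F : ℕ → Fin α.circles × Fin α.squares → ℝ)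
    (hF : ∀ p, F 0 p = 1) :
    (α.edges.map fun e => F e.2.2 (e.1, e.2.1)).prod = ∏ p, F (α.edgeLabel p) p := by
  have h : (α.edges.map fun e => F e.2.2 (e.1, e.2.1)) =
      (α.edges.map (fun e => (e.1, e.2.1))).map fun p => F (α.edgeLabel p) p := by
    rw [Multiset.map_map]
    exact Multiset.map_congr rfl fun e he => by simp [edgeLabel_of_mem hα he]
  rw [h, map_endpoints_eq hα]
  refine Finset.prod_subset (Finset.subset_univ _) fun p _ hp => ?_
  have : α.edgeLabel p = 0 := by simpa using hp
  rw [this, hF]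

theorem totalLabel_eq {α : Shape} (hα : α.IsProper) : α.totalLabel = ∑ p, α.edgeLabel p := by
  have h : (α.edges.map fun e => e.2.2) =
      (α.edges.map (fun e => (e.1, e.2.1))).map fun p => α.edgeLabel p := by
    rw [Multiset.map_map]
    exact Multiset.map_congr rfl fun e he => by simp [edgeLabel_of_mem hα he]
  rw [totalLabel, h, map_endpoints_eq hα]
  refine Finset.sum_subset (Finset.subset_univ _) fun p _ hp => ?_
  simpa using hp

theorem graph_adj_iff (a b : α.Vertex) : α.graph.Adj a b ↔
    ∃ p, α.edgeLabel p ≠ 0 ∧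
      ((a = Sum.inl p.1 ∧ b = Sum.inr p.2) ∨ (b = Sum.inl p.1 ∧ a = Sum.inr p.2)) := by
  simp only [graph, SimpleGraph.fromRel_adj, edgeLabel_ne_zero_iff]
  constructor
  · rintro ⟨-, ⟨e, he, h⟩ | ⟨e, he, h⟩⟩
    · exact ⟨_, ⟨e, he, rfl⟩, Or.inl h⟩
    · exact ⟨_, ⟨e, he, rfl⟩, Or.inr h⟩
  · rintro ⟨_, ⟨e, he, rfl⟩, h | h⟩
    · exact ⟨by rw [h.1, h.2]; simp, Or.inl ⟨e, he, h⟩⟩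
    · exact ⟨by rw [h.1, h.2]; simp, Or.inr ⟨e, he, h⟩⟩

end Labels

/-! ### Labellings and the entries of the graph matrix -/

section Labellings
variable (α : Shape) (n d : ℕ)

/-- The injective labellings of the circles by `[n]` and of the squares by `[d]`. -/
abbrev Labelling : Type := (Fin α.circles ↪ Fin n) × (Fin α.squares ↪ Fin d)

variable {n d}

/-- The labels of the vertices in `U_α`. -/
def row (ψ : α.Labelling n d) : α.RowIndex n d := (α.leftC.trans ψ.1, α.leftS.trans ψ.2)

/-- The labels of the vertices in `V_α`. -/
def col (ψ : α.Labelling n d) : α.ColIndex n d := (α.rightC.trans ψ.1, α.rightS.trans ψ.2)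

/-- The labelling as a map on vertices. -/
def value (ψ : α.Labelling n d) : α.Vertex → Fin n ⊕ Fin d := Sum.map ψ.1 ψ.2

theorem value_injective (ψ : α.Labelling n d) : Function.Injective (α.value ψ) :=
  ψ.1.injective.sumMap ψ.2.injective

theorem value_eq_of_row_eq {ψ ψ' : α.Labelling n d} (h : α.row ψ = α.row ψ') :
    ∀ a ∈ α.leftSet, α.value ψ a = α.value ψ' a := by
  have h1 := congrArg Prod.fst h
  have h2 := congrArg Prod.snd h
  rintro a (⟨_, ⟨i, rfl⟩, rfl⟩ | ⟨_, ⟨i, rfl⟩, rfl⟩)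
  · simpa [value, row] using DFunLike.congr_fun h1 i
  · simpa [value, row] using DFunLike.congr_fun h2 i

theorem value_eq_of_col_eq {ψ ψ' : α.Labelling n d} (h : α.col ψ = α.col ψ') :
    ∀ a ∈ α.rightSet, α.value ψ a = α.value ψ' a := by
  have h1 := congrArg Prod.fst h
  have h2 := congrArg Prod.snd h
  rintro a (⟨_, ⟨i, rfl⟩, rfl⟩ | ⟨_, ⟨i, rfl⟩, rfl⟩)
  · simpa [value, col] using DFunLike.congr_fun h1 i
  · simpa [value, col] using DFunLike.congr_fun h2 i

/-- The product of Hermite polynomials that a labelling contributes to the graph matrix. -/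
noncomputable def term (ψ : α.Labelling n d) (x : Fin n × Fin d → ℝ) : ℝ :=
  ∏ p, hermiteNormalized (α.edgeLabel p) (x (ψ.1 p.1, ψ.2 p.2))

theorem hermiteNormalized_zero (z : ℝ) : hermiteNormalized 0 z = 1 := by
  simp [hermiteNormalized]

open Classical in
theorem graphMatrix_apply {α : Shape} (hα : α.IsProper) (x : Fin n × Fin d → ℝ)
    (A : α.RowIndex n d) (B : α.ColIndex n d) :
    α.graphMatrix (fun i k => x (i, k)) A B =
      ∑ ψ : α.Labelling n d, if α.row ψ = A ∧ α.col ψ = B then α.term ψ x else 0 := by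
  rw [Fintype.sum_prod_type, graphMatrix, Matrix.of_apply]
  refine Finset.sum_congr rfl fun π _ => Finset.sum_congr rfl fun σ _ => ?_
  have h1 : (α.row (π, σ) = A ∧ α.col (π, σ) = B) ↔ (α.leftC.trans π = A.1 ∧
      α.leftS.trans σ = A.2 ∧ α.rightC.trans π = B.1 ∧ α.rightS.trans σ = B.2) := by
    simp only [row, col, Prod.ext_iff, and_assoc]
  simp only [h1]
  congr 1
  exact prod_map_edges hα (fun j p => hermiteNormalized j (x (π p.1, σ p.2)))
    fun p => hermiteNormalized_zero _

/-- The edge labels transported along a labelling. -/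
noncomputable def labelAt (ψ : α.Labelling n d) : Fin n × Fin d → ℕ :=
  Function.extend (fun p : Fin α.circles × Fin α.squares => (ψ.1 p.1, ψ.2 p.2)) α.edgeLabel 0

theorem labelling_pair_injective (ψ : α.Labelling n d) :
    Function.Injective fun p : Fin α.circles × Fin α.squares => (ψ.1 p.1, ψ.2 p.2) :=
  ψ.1.injective.prodMap ψ.2.injective

theorem labelAt_apply (ψ : α.Labelling n d) (p : Fin α.circles × Fin α.squares) :
    α.labelAt ψ (ψ.1 p.1, ψ.2 p.2) = α.edgeLabel p :=
  (α.labelling_pair_injective ψ).extend_apply _ _ p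

theorem labelAt_of_notMem (ψ : α.Labelling n d) {y : Fin n × Fin d}
    (h : y ∉ Set.range fun p : Fin α.circles × Fin α.squares => (ψ.1 p.1, ψ.2 p.2)) :
    α.labelAt ψ y = 0 :=
  Function.extend_apply' _ _ _ h

/-- Indexing by entries of the array instead of pairs of vertices brings together the factors, from
different copies, that involve the same Gaussian variable. -/
theorem term_eq (ψ : α.Labelling n d) (x : Fin n × Fin d → ℝ) :
    α.term ψ x = ∏ y, hermiteNormalized (α.labelAt ψ y) (x y) :=
  Fintype.prod_of_injective _ (α.labelling_pair_injective ψ) _ _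
    (fun y hy => by rw [α.labelAt_of_notMem ψ hy, hermiteNormalized_zero])
    fun p => by rw [labelAt_apply]

theorem sum_labelAt {α : Shape} (hα : α.IsProper) (ψ : α.Labelling n d) :
    ∑ y, α.labelAt ψ y = α.totalLabel := by
  rw [totalLabel_eq hα]
  exact (Fintype.sum_of_injective _ (α.labelling_pair_injective ψ) _ _
    (fun y hy => α.labelAt_of_notMem ψ hy) fun p => (labelAt_apply _ _ _).symm).symm

end Labellings

/-! ### Expectation of a product of labelled copies -/

section Expectation
variable {α : Shape} {n d : ℕ} {T : Type*} [Fintype T]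

/-- The law of an array of independent standard Gaussian variables. -/
noncomputable abbrev gaussianArray (n d : ℕ) : Measure (Fin n × Fin d → ℝ) :=
  Measure.pi fun _ => gaussianReal 0 1

theorem prod_term_eq (ψ : T → α.Labelling n d) (x : Fin n × Fin d → ℝ) :
    ∏ t, α.term (ψ t) x = ∏ y, ∏ t, hermiteNormalized (α.labelAt (ψ t) y) (x y) := by
  simp only [term_eq]
  exact Finset.prod_comm

theorem integrable_prod_term (ψ : T → α.Labelling n d) :
    Integrable (fun x => ∏ t, α.term (ψ t) x) (gaussianArray n d) := by
  simp only [prod_term_eq]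
  refine Integrable.fintype_prod (f := fun y z => ∏ t, hermiteNormalized (α.labelAt (ψ t) y) z)
    fun y => ?_
  refine (integrable_eval_gaussianReal (∏ t, hermitePoly (α.labelAt (ψ t) y))).congr
    (ae_of_all _ fun z => ?_)
  simp only [Polynomial.eval_prod, eval_hermitePoly]

theorem integral_prod_term (ψ : T → α.Labelling n d) :
    ∫ x, ∏ t, α.term (ψ t) x ∂gaussianArray n d =
      ∏ y, hermiteMoment fun t => α.labelAt (ψ t) y := by
  simp only [prod_term_eq]
  exact integral_fintype_prod_eq_prod
    (f := fun y z => ∏ t, hermiteNormalized (α.labelAt (ψ t) y) z)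

variable [DecidableEq T]

theorem integral_prod_term_le (hα : α.IsProper) (ψ : T → α.Labelling n d) :
    ∫ x, ∏ t, α.term (ψ t) x ∂gaussianArray n d ≤
      √((Fintype.card T : ℝ) - 1) ^ (Fintype.card T * α.totalLabel) := by
  rw [integral_prod_term]
  refine (Finset.prod_le_prod (fun y _ => (hermiteMoment_bounds _).1)
    fun y _ => (hermiteMoment_bounds _).2).trans (le_of_eq ?_)
  rw [Finset.prod_pow_eq_pow_sum, Finset.sum_comm]
  simp only [sum_labelAt hα, Finset.sum_const, Finset.card_univ, smul_eq_mul]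

/-- If no other copy used the entry under this edge, its moment would be the mean of a single
nonconstant Hermite polynomial, which is zero. -/
theorem exists_edge_copy_of_integral_ne_zero (ψ : T → α.Labelling n d)
    (h : ∫ x, ∏ t, α.term (ψ t) x ∂gaussianArray n d ≠ 0) (t : T)
    (p : Fin α.circles × Fin α.squares) (hp : α.edgeLabel p ≠ 0) :
    ∃ t', t' ≠ t ∧ ∃ p', α.edgeLabel p' ≠ 0 ∧ (ψ t').1 p'.1 = (ψ t).1 p.1 ∧
      (ψ t').2 p'.2 = (ψ t).2 p.2 := by
  rw [integral_prod_term, Finset.prod_ne_zero_iff] at h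
  have h1 := h ((ψ t).1 p.1, (ψ t).2 p.2) (Finset.mem_univ _)
  have h2 : ∃ t', t' ≠ t ∧ α.labelAt (ψ t') ((ψ t).1 p.1, (ψ t).2 p.2) ≠ 0 := by
    by_contra! hne
    exact h1 (hermiteMoment_eq_zero _ t (by rwa [labelAt_apply]) hne)
  obtain ⟨t', ht', hl⟩ := h2
  refine ⟨t', ht', ?_⟩
  by_cases hr : ((ψ t).1 p.1, (ψ t).2 p.2) ∈
      Set.range fun p : Fin α.circles × Fin α.squares => ((ψ t').1 p.1, (ψ t').2 p.2)
  · obtain ⟨p', hp'⟩ := hr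
    have hp'' := hp'
    rw [← hp', labelAt_apply] at hl
    exact ⟨p', hl, congrArg Prod.fst hp'', congrArg Prod.snd hp''⟩
  · exact absurd (α.labelAt_of_notMem _ hr) hl

end Expectation

/-! ### Weights of active and isolated vertices -/

section Weights
variable (α : Shape) (n d : ℕ)

open Classical in
/-- The circles that are not isolated vertices outside `U_α ∪ V_α`. -/
noncomputable def activeC : Finset (Fin α.circles) := {a | Sum.inl a ∉ α.iso}

open Classical in
/-- The squares that are not isolated vertices outside `U_α ∪ V_α`. -/
noncomputable def activeS : Finset (Fin α.squares) := {a | Sum.inr a ∉ α.iso}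

/-- The vertices that are not isolated vertices outside `U_α ∪ V_α`. -/
noncomputable def active : Finset α.Vertex := α.activeC.disjSum α.activeS

theorem mem_active (a : α.Vertex) : a ∈ α.active ↔ a ∉ α.iso := by
  rcases a with a | a <;> simp [active, activeC, activeS]

theorem mem_active_iff (a : α.Vertex) :
    a ∈ α.active ↔ a ∈ α.leftSet ∨ a ∈ α.rightSet ∨ ∃ b, α.graph.Adj a b := by
  simp only [mem_active, iso, Finset.mem_filter, Finset.mem_univ, true_and]
  simp only [not_and, not_forall, not_not]
  tauto

theorem weight_iso : α.weight n d α.iso =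
    (α.activeC)ᶜ.card + (α.activeS)ᶜ.card * Real.logb n d := by
  have h : α.iso = (α.activeC)ᶜ.disjSum (α.activeS)ᶜ := by
    ext a
    rcases a with a | a <;> simp [activeC, activeS]
  rw [h]
  simp [weight, Finset.sum_disjSum, vertexWeight]

theorem weight_univ : α.weight n d Finset.univ =
    α.weight n d α.active + α.weight n d α.iso := by
  classical
  rw [weight, weight, weight, ← Finset.sum_filter_add_sum_filter_not _ (· ∈ α.active)]
  congr 2
  · ext a; simp
  · ext a; simp [mem_active]

variable {n d}

theorem vertexWeight_le_one (hn : 2 ≤ n) (hd : 1 ≤ d) (hdn : d ≤ n) (a : α.Vertex) :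
    α.vertexWeight n d a ≤ 1 := by
  rcases a with a | a
  · simp [vertexWeight]
  · simp only [vertexWeight, Sum.elim_inr]
    rw [Real.logb_le_iff_le_rpow (by exact_mod_cast hn) (by exact_mod_cast hd), Real.rpow_one]
    exact_mod_cast hdn

open Classical in
/-- `U_α` as a finite set. -/
noncomputable def leftFinset : Finset α.Vertex := {a | a ∈ α.leftSet}

theorem card_leftFinset_le : α.leftFinset.card ≤ α.leftSize := by
  classical
  have h : α.leftFinset = (Finset.univ.image α.leftC).disjSum (Finset.univ.image α.leftS) := by
    ext a
    rcases a with a | a <;> simp [leftFinset, leftSet]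
  rw [h, Finset.card_disjSum, leftSize]
  refine add_le_add ?_ ?_
  · simpa using Finset.card_image_le (s := Finset.univ) (f := α.leftC)
  · simpa using Finset.card_image_le (s := Finset.univ) (f := α.leftS)

/-- The weight of a label: `1` for an element of `[n]` and `log_n d` for an element of `[d]`. -/
noncomputable def valueWeight (n d : ℕ) : Fin n ⊕ Fin d → ℝ :=
  Sum.elim (fun _ => 1) fun _ => Real.logb n d

theorem valueWeight_value (ψ : α.Labelling n d) (a : α.Vertex) :
    valueWeight n d (α.value ψ a) = α.vertexWeight n d a := by
  rcases a with a | a <;> simp [valueWeight, value, vertexWeight]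

end Weights

/-! ### Closed walks of copies and the number of their labels -/

section ClosedWalks
variable {α : Shape} {n d : ℕ}

/-- The position of the `i`-th copy of `M_α` (for `false`) and of its transpose (for `true`). -/
def copyTime {q : ℕ} (z : Fin q × Bool) : ℤ := 2 * (z.1 : ℕ) + if z.2 then 1 else 0

theorem copyTime_injective {q : ℕ} : Function.Injective (copyTime (q := q)) := by
  rintro ⟨i, b⟩ ⟨i', b'⟩ h
  simp only [copyTime] at h
  have : (i : ℕ) = i' ∧ b = b' := by
    cases b <;> cases b' <;> simp at h ⊢ <;> omega
  exact Prod.ext (Fin.ext this.1) this.2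

/-- The labellings of the successive copies along a walk. -/
def copies {q : ℕ} (p : Fin q → α.Labelling n d × α.Labelling n d) (z : Fin q × Bool) :
    α.Labelling n d :=
  if z.2 then (p z.1).2 else (p z.1).1

theorem copies_injective {q : ℕ} : Function.Injective (copies (α := α) (n := n) (d := d) (q := q)) := by
  intro p p' h
  funext i
  exact Prod.ext (by simpa [copies] using congrFun h (i, false))
    (by simpa [copies] using congrFun h (i, true))

/-- The walk from `A` to `A` through copies of `M_α` and of its transpose. -/
def IsClosedWalk {q : ℕ} (A : α.RowIndex n d) (p : Fin q → α.Labelling n d × α.Labelling n d) :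
    Prop :=
  IsArcWalk (fun x : α.Labelling n d × α.Labelling n d => α.row x.1) (fun x => α.row x.2) A A p ∧
    ∀ i, α.col (p i).1 = α.col (p i).2

/-- Within a pair the two copies share their column, and between pairs they share their row. Only
the row at the start of the first pair and at the end of the last has no such neighbour; both equal
`A`, whose labels are put in `base`. -/
theorem occursBefore_of_isClosedWalk {q : ℕ} {A : α.RowIndex n d}
    {p : Fin (q + 1) → α.Labelling n d × α.Labelling n d} (hp : IsClosedWalk A p)
    (base : Finset (Fin n ⊕ Fin d))
    (hbase : ∀ a ∈ α.leftSet, α.value (copies p (0, false)) a ∈ base) (t : Fin (q + 1) × Bool) :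
    ((∀ a ∈ α.leftSet, OccursBefore copyTime (fun t => α.value (copies p t)) α.active base t a) ∧
        ∀ b ∈ α.rightSet,
          OccursBefore (-copyTime) (fun t => α.value (copies p t)) α.active base t b) ∨
      ((∀ a ∈ α.leftSet,
          OccursBefore (-copyTime) (fun t => α.value (copies p t)) α.active base t a) ∧
        ∀ b ∈ α.rightSet,
          OccursBefore copyTime (fun t => α.value (copies p t)) α.active base t b) := by
  obtain ⟨⟨z, h0, h1, hz'⟩, hcol⟩ := hp
  have hz : ∀ i, α.row (p i).1 = z i.castSucc ∧ α.row (p i).2 = z i.succ := hz'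
  have hbase' : ∀ ψ : α.Labelling n d, α.row ψ = A → ∀ a ∈ α.leftSet, α.value ψ a ∈ base := by
    intro ψ hψ a ha
    have : α.row ψ = α.row (copies p (0, false)) := by
      rw [hψ, ← h0]; exact ((hz 0).1).symm
    rw [α.value_eq_of_row_eq this a ha]
    exact hbase a ha
  have hl : ∀ a ∈ α.leftSet, a ∈ α.active := fun a ha => (α.mem_active_iff a).2 (Or.inl ha)
  have hr : ∀ a ∈ α.rightSet, a ∈ α.active :=
    fun a ha => (α.mem_active_iff a).2 (Or.inr (Or.inl ha))
  obtain ⟨i, b⟩ := t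
  cases b with
  | false =>
    refine Or.inl ⟨fun a ha => ?_, fun b hb => Or.inr ⟨(i, true), by simp [copyTime], b, hr b hb,
      (α.value_eq_of_col_eq (hcol i) b hb).symm⟩⟩
    rcases Fin.eq_zero_or_eq_succ i with rfl | ⟨j, rfl⟩
    · exact Or.inl (hbase a ha)
    · refine Or.inr ⟨(j.castSucc, true), by simp [copyTime]; omega, a, hl a ha,
        α.value_eq_of_row_eq ?_ a ha⟩
      change α.row (p j.castSucc).2 = α.row (p j.succ).1
      rw [(hz j.castSucc).2, (hz j.succ).1]; rfl
  | true =>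
    refine Or.inr ⟨fun a ha => ?_, fun b hb => Or.inr ⟨(i, false), by simp [copyTime], b, hr b hb,
      α.value_eq_of_col_eq (hcol i) b hb⟩⟩
    rcases Fin.eq_castSucc_or_eq_last i with ⟨j, rfl⟩ | rfl
    · refine Or.inr ⟨(j.succ, false), by simp [copyTime]; omega, a, hl a ha,
        α.value_eq_of_row_eq ?_ a ha⟩
      change α.row (p j.succ).1 = α.row (p j.castSucc).2
      rw [(hz j.castSucc).2, (hz j.succ).1]; rfl
    · refine Or.inl (hbase' _ ?_ a ha)
      change α.row (p (Fin.last q)).2 = A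
      rw [(hz (Fin.last q)).2, Fin.succ_last, h1]

open Classical in
/-- The number of labels of circles that occur on active vertices. -/
noncomputable def numValuesC {T : Type*} [Fintype T] (ψ : T → α.Labelling n d) : ℕ :=
  ((Finset.univ ×ˢ α.activeC).image fun z : T × Fin α.circles => (ψ z.1).1 z.2).card

open Classical in
/-- The number of labels of squares that occur on active vertices. -/
noncomputable def numValuesS {T : Type*} [Fintype T] (ψ : T → α.Labelling n d) : ℕ :=
  ((Finset.univ ×ˢ α.activeS).image fun z : T × Fin α.squares => (ψ z.1).2 z.2).card

/-- The separator estimate for the `2 * (q + 1)` copies, halved. The final `1` pays for the labels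
in `base`, at most one because `|U| ≤ 1`, of weight at most `1` because `d ≤ n`. -/
theorem numValues_le {q : ℕ} (hn : 2 ≤ n) (hd : 1 ≤ d) (hdn : d ≤ n)
    (hleft : α.leftSize ≤ 1) {S : Finset α.Vertex} (hS : α.IsMinSeparator n d S)
    {A : α.RowIndex n d} {p : Fin (q + 1) → α.Labelling n d × α.Labelling n d}
    (hp : IsClosedWalk A p)
    (hint : ∫ x, ∏ t, α.term (copies p t) x ∂gaussianArray n d ≠ 0) :
    (numValuesC (copies p) : ℝ) + numValuesS (copies p) * Real.logb n d ≤
      (q + 1) * (α.weight n d α.active - α.weight n d S) + 1 := by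
  classical
  set Ψ : Fin (q + 1) × Bool → α.Vertex → Fin n ⊕ Fin d := fun t => α.value (copies p t) with hΨ
  set base : Finset (Fin n ⊕ Fin d) := α.leftFinset.image (Ψ (0, false)) with hbase
  have hmain := two_mul_sum_values_le (copyTime_injective (q := q + 1)) (Ψ := Ψ)
    (fun t => α.value_injective _) α.active base α.graph α.leftSet α.rightSet
    (fun a ha => (α.mem_active_iff a).2 (Or.inl ha))
    (fun a b h => (α.mem_active_iff a).2 (Or.inr (Or.inr ⟨b, h⟩)))
    (fun a ha => (α.mem_active_iff a).1 ha)
    (by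
      intro t a b hab
      have hact : ∀ p', α.edgeLabel p' ≠ 0 →
          (Sum.inl p'.1 : α.Vertex) ∈ α.active ∧ (Sum.inr p'.2 : α.Vertex) ∈ α.active := by
        intro p' hp'
        have h1 : α.graph.Adj (Sum.inl p'.1) (Sum.inr p'.2) :=
          (α.graph_adj_iff _ _).2 ⟨p', hp', Or.inl ⟨rfl, rfl⟩⟩
        exact ⟨(α.mem_active_iff _).2 (Or.inr (Or.inr ⟨_, h1⟩)),
          (α.mem_active_iff _).2 (Or.inr (Or.inr ⟨_, h1.symm⟩))⟩
      obtain ⟨e, he, hab⟩ := (α.graph_adj_iff a b).1 hab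
      obtain ⟨t', ht', e', he', hc, hs⟩ := exists_edge_copy_of_integral_ne_zero _ hint t e he
      have h1 : Ψ t' (Sum.inl e'.1) = Ψ t (Sum.inl e.1) := by simp [hΨ, value, hc]
      have h2 : Ψ t' (Sum.inr e'.2) = Ψ t (Sum.inr e.2) := by simp [hΨ, value, hs]
      refine ⟨t', ht', ?_⟩
      rcases hab with ⟨rfl, rfl⟩ | ⟨rfl, rfl⟩
      · exact ⟨⟨_, (hact e' he').1, h1⟩, _, (hact e' he').2, h2⟩
      · exact ⟨⟨_, (hact e' he').2, h2⟩, _, (hact e' he').1, h1⟩)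
    (occursBefore_of_isClosedWalk hp base fun a ha =>
      Finset.mem_image_of_mem _ (by simpa [leftFinset] using ha))
    (α.vertexWeight n d) (valueWeight n d) (fun t a => α.valueWeight_value _ a)
    (α.weight n d S) fun N hN => hS.2 N fun a ha b hb p _ => hN a ha b hb p
  have hbase1 : ∑ x ∈ base, valueWeight n d x ≤ 1 := by
    have hc : base.card ≤ 1 := Finset.card_image_le.trans (α.card_leftFinset_le.trans hleft)
    refine (Finset.sum_le_card_nsmul _ _ 1 fun x hx => ?_).trans ?_
    · obtain ⟨a, -, rfl⟩ := Finset.mem_image.1 hx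
      rw [hΨ, valueWeight_value]
      exact α.vertexWeight_le_one hn hd hdn a
    · simpa using hc
  have hvnn : ∀ x : Fin n ⊕ Fin d, 0 ≤ valueWeight n d x := by
    rintro (x | x)
    · simp [valueWeight]
    · exact Real.logb_nonneg (by exact_mod_cast hn) (by exact_mod_cast hd)
  have himg : (Finset.univ ×ˢ α.active).image
      (fun z : (Fin (q + 1) × Bool) × α.Vertex => Ψ z.1 z.2) =
      ((Finset.univ ×ˢ α.activeC).image fun z : (Fin (q + 1) × Bool) × Fin α.circles =>
        (copies p z.1).1 z.2).disjSum
      ((Finset.univ ×ˢ α.activeS).image fun z : (Fin (q + 1) × Bool) × Fin α.squares =>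
        (copies p z.1).2 z.2) := by
    ext x
    rcases x with x | x <;> simp [active, hΨ, value]
  have hsum : ∑ x ∈ (Finset.univ ×ˢ α.active).image
      (fun z : (Fin (q + 1) × Bool) × α.Vertex => Ψ z.1 z.2), valueWeight n d x =
      (numValuesC (copies p) : ℝ) + numValuesS (copies p) * Real.logb n d := by
    rw [himg, Finset.sum_disjSum]
    simp [valueWeight, numValuesC, numValuesS]
  have hsplit : ∑ x ∈ (Finset.univ ×ˢ α.active).image
      (fun z : (Fin (q + 1) × Bool) × α.Vertex => Ψ z.1 z.2), valueWeight n d x ≤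
      ∑ x ∈ (Finset.univ ×ˢ α.active).image
        (fun z : (Fin (q + 1) × Bool) × α.Vertex => Ψ z.1 z.2) \ base, valueWeight n d x +
      ∑ x ∈ base, valueWeight n d x := by
    rw [← Finset.sum_inter_add_sum_sdiff _ base, add_comm]
    gcongr
    · exact fun i _ _ => hvnn i
    · exact Finset.inter_subset_right
  have hcard : (Fintype.card (Fin (q + 1) × Bool) : ℝ) = 2 * (q + 1) := by
    simp; ring
  rw [hcard] at hmain
  change 2 * _ ≤ 2 * ((q : ℝ) + 1) * (α.weight n d α.active - α.weight n d S) at hmain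
  linarith

/-- Forgetting that labellings are injective enlarges the sum to all pairs of functions, where it
factors into circles and squares. Inactive vertices are free and give the powers of `n` and `d`. -/
theorem sum_inv_pow_numValues_le {T : Type*} [Fintype T] [DecidableEq T] :
    ∑ ψ : T → α.Labelling n d, ((n : ℝ)⁻¹) ^ numValuesC ψ * ((d : ℝ)⁻¹) ^ numValuesS ψ ≤
      ((n : ℝ) ^ (Fintype.card T * (α.activeC)ᶜ.card) *
        (Fintype.card T * α.activeC.card).factorial) *
      ((d : ℝ) ^ (Fintype.card T * (α.activeS)ᶜ.card) *
        (Fintype.card T * α.activeS.card).factorial) := by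
  have hC := sum_inv_pow_card_image_subset_le (K := T × Fin α.circles) (n := n)
    (Finset.univ ×ˢ α.activeC)
  have hS := sum_inv_pow_card_image_subset_le (K := T × Fin α.squares) (n := d)
    (Finset.univ ×ˢ α.activeS)
  have hcC : (Finset.univ ×ˢ α.activeC : Finset (T × Fin α.circles))ᶜ.card =
      Fintype.card T * (α.activeC)ᶜ.card := by
    rw [Finset.card_compl, Finset.card_compl, Finset.card_product, Fintype.card_prod,
      Finset.card_univ, Nat.mul_sub]
  have hcS : (Finset.univ ×ˢ α.activeS : Finset (T × Fin α.squares))ᶜ.card =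
      Fintype.card T * (α.activeS)ᶜ.card := by
    rw [Finset.card_compl, Finset.card_compl, Finset.card_product, Fintype.card_prod,
      Finset.card_univ, Nat.mul_sub]
  rw [hcC, Finset.card_product, Finset.card_univ] at hC
  rw [hcS, Finset.card_product, Finset.card_univ] at hS
  refine le_trans ?_ (mul_le_mul hC hS (Finset.sum_nonneg fun _ _ => by positivity) (by positivity))
  rw [Finset.sum_mul_sum, ← Finset.sum_product']
  let ι : (T → α.Labelling n d) → (T × Fin α.circles → Fin n) × (T × Fin α.squares → Fin d) :=
    fun ψ => (fun z => (ψ z.1).1 z.2, fun z => (ψ z.1).2 z.2)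
  have hι : Function.Injective ι := by
    intro ψ ψ' h
    funext t
    refine Prod.ext (DFunLike.ext _ _ fun a => ?_) (DFunLike.ext _ _ fun a => ?_)
    · exact congrFun (congrArg Prod.fst h) (t, a)
    · exact congrFun (congrArg Prod.snd h) (t, a)
  have hf := Finset.sum_map Finset.univ ⟨ι, hι⟩
    (fun F : (T × Fin α.circles → Fin n) × (T × Fin α.squares → Fin d) =>
      ((n : ℝ)⁻¹) ^ ((Finset.univ ×ˢ α.activeC).image F.1).card *
      ((d : ℝ)⁻¹) ^ ((Finset.univ ×ˢ α.activeS).image F.2).card)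
  refine le_trans (le_of_eq ?_) (hf.symm.le.trans (Finset.sum_le_sum_of_subset_of_nonneg
    (Finset.subset_univ _) fun _ _ _ => by positivity))
  refine Finset.sum_congr rfl fun ψ _ => ?_
  rfl

end ClosedWalks

/-! ### The trace moment of the graph matrix -/

section TraceMoment
variable {α : Shape} {n d : ℕ}

open Classical in
theorem graphMatrix_mul_transpose (hα : α.IsProper) (x : Fin n × Fin d → ℝ) :
    α.graphMatrix (fun i k => x (i, k)) * (α.graphMatrix fun i k => x (i, k)).transpose =
      Matrix.of fun A A' => ∑ p : α.Labelling n d × α.Labelling n d,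
        if α.row p.1 = A ∧ α.row p.2 = A' then
          (if α.col p.1 = α.col p.2 then α.term p.1 x * α.term p.2 x else 0) else 0 := by
  ext A A'
  simp only [Matrix.mul_apply, Matrix.transpose_apply, graphMatrix_apply hα, Matrix.of_apply]
  simp only [Finset.sum_mul_sum]
  conv_rhs => rw [Fintype.sum_prod_type]
  rw [Finset.sum_comm]
  refine Finset.sum_congr rfl fun ψ _ => ?_
  rw [Finset.sum_comm]
  refine Finset.sum_congr rfl fun ψ' _ => ?_
  rw [Finset.sum_eq_single (α.col ψ)]
  · by_cases h1 : α.row ψ = A <;> by_cases h2 : α.row ψ' = A' <;>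
      by_cases h3 : α.col ψ = α.col ψ' <;> simp [h1, h2, h3, eq_comm]
  · intro B _ hB
    rw [if_neg fun h => hB h.2.symm, zero_mul]
  · simp

theorem prod_copies {q : ℕ} (p : Fin q → α.Labelling n d × α.Labelling n d)
    (f : α.Labelling n d → ℝ) :
    ∏ z, f (copies p z) = ∏ i, f (p i).1 * f (p i).2 := by
  rw [Fintype.prod_prod_type]
  refine Finset.prod_congr rfl fun i _ => ?_
  simp [copies, mul_comm]

open Classical in
theorem trace_pow_eq (hα : α.IsProper) (x : Fin n × Fin d → ℝ) (q : ℕ) :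
    ((α.graphMatrix (fun i k => x (i, k)) *
        (α.graphMatrix fun i k => x (i, k)).transpose) ^ q).trace =
      ∑ A : α.RowIndex n d, ∑ p : Fin q → α.Labelling n d × α.Labelling n d,
        if IsClosedWalk A p then ∏ z, α.term (copies p z) x else 0 := by
  rw [graphMatrix_mul_transpose hα, Matrix.trace]
  refine Finset.sum_congr rfl fun A _ => ?_
  rw [Matrix.diag_apply, pow_apply_eq_sum_arcWalk]
  refine Finset.sum_congr rfl fun p _ => ?_
  rw [prod_copies p fun ψ => α.term ψ x]
  unfold IsClosedWalk
  by_cases h1 : IsArcWalk (fun x : α.Labelling n d × α.Labelling n d => α.row x.1)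
      (fun x => α.row x.2) A A p
  · by_cases h2 : ∀ i, α.col (p i).1 = α.col (p i).2
    · simp [h1, h2]
    · rw [if_pos h1, if_neg fun h => h2 h.2]
      push Not at h2
      obtain ⟨i, hi⟩ := h2
      exact Finset.prod_eq_zero (Finset.mem_univ i) (if_neg hi)
  · simp [h1]

theorem integrable_trace_pow (hα : α.IsProper) (q : ℕ) :
    Integrable (fun x => ((α.graphMatrix (fun i k => x (i, k)) *
        (α.graphMatrix fun i k => x (i, k)).transpose) ^ q).trace) (gaussianArray n d) := by
  classical
  simp only [trace_pow_eq hα]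
  refine integrable_finsetSum _ fun A _ => integrable_finsetSum _ fun p _ => ?_
  split_ifs
  · exact integrable_prod_term _
  · exact integrable_zero _ _ _

theorem integral_trace_pow_le (hα : α.IsProper) (hn : 2 ≤ n) (hd : 1 ≤ d) (hdn : d ≤ n)
    (hleft : α.leftSize ≤ 1) {S : Finset α.Vertex} (hS : α.IsMinSeparator n d S) (q : ℕ) :
    ∫ x, ((α.graphMatrix (fun i k => x (i, k)) *
        (α.graphMatrix fun i k => x (i, k)).transpose) ^ (q + 1)).trace ∂gaussianArray n d ≤
      √((2 * (q + 1) : ℕ) - 1 : ℝ) ^ (2 * (q + 1) * α.totalLabel) *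
        (n * (n : ℝ) ^ ((q + 1) * (α.weight n d Finset.univ - α.weight n d S +
          α.weight n d α.iso))) *
        ((2 * (q + 1) * α.activeC.card).factorial * (2 * (q + 1) * α.activeS.card).factorial) := by
  classical
  have hn0 : (0 : ℝ) < n := by positivity
  have hd0 : (0 : ℝ) < d := by positivity
  have hn1 : (1 : ℝ) < n := by exact_mod_cast hn
  have hcard : Fintype.card (Fin (q + 1) × Bool) = 2 * (q + 1) := by simp; ring
  set R : ℝ := √((2 * (q + 1) : ℕ) - 1 : ℝ) ^ (2 * (q + 1) * α.totalLabel) with hR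
  set D : ℝ := (q + 1) * (α.weight n d α.active - α.weight n d S) + 1 with hD
  have hR0 : 0 ≤ R := by positivity
  simp only [trace_pow_eq hα]
  rw [integral_finsetSum _ fun A _ => integrable_finsetSum _ fun p _ => by
    split_ifs
    · exact integrable_prod_term _
    · exact integrable_zero _ _ _]
  have hlogb : ∀ k : ℕ, (n : ℝ) ^ ((k : ℝ) * Real.logb n d) = (d : ℝ) ^ k := by
    intro k
    rw [mul_comm, Real.rpow_mul hn0.le, Real.rpow_logb hn0 hn1.ne' hd0, Real.rpow_natCast]
  have hterm : ∀ (p : Fin (q + 1) → α.Labelling n d × α.Labelling n d),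
      ∑ A : α.RowIndex n d, (if IsClosedWalk A p then
        ∫ x, ∏ z, α.term (copies p z) x ∂gaussianArray n d else 0) ≤
      R * (n : ℝ) ^ D * (((n : ℝ)⁻¹) ^ numValuesC (copies p) *
        ((d : ℝ)⁻¹) ^ numValuesS (copies p)) := by
    intro p
    have hnn : 0 ≤ R * (n : ℝ) ^ D * (((n : ℝ)⁻¹) ^ numValuesC (copies p) *
        ((d : ℝ)⁻¹) ^ numValuesS (copies p)) := by positivity
    -- The base point of a closed walk is determined by its first copy.
    rw [Finset.sum_eq_single (α.row (p 0).1) (fun A _ hA => if_neg fun h => hA ?_) (by simp)]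
    · split_ifs with hw
      · by_cases h0 : ∫ x, ∏ z, α.term (copies p z) x ∂gaussianArray n d = 0
        · rw [h0]; exact hnn
        · have hle := integral_prod_term_le hα (copies p)
          rw [hcard] at hle
          have hnum := numValues_le hn hd hdn hleft hS hw h0
          -- By the bound on the number of labels, the weight of a contributing walk is at least `1`
          -- after multiplication by `n ^ D`; this replaces a count of walks by a weighted sum.
          have hone : 1 ≤ (n : ℝ) ^ D * (((n : ℝ)⁻¹) ^ numValuesC (copies p) *
              ((d : ℝ)⁻¹) ^ numValuesS (copies p)) := by
            rw [inv_pow, inv_pow, ← mul_inv, ← div_eq_mul_inv, one_le_div (by positivity),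
              ← hlogb, ← Real.rpow_natCast, ← Real.rpow_add hn0]
            exact Real.rpow_le_rpow_of_exponent_le hn1.le hnum
          calc _ ≤ R := hle
            _ ≤ R * ((n : ℝ) ^ D * (((n : ℝ)⁻¹) ^ numValuesC (copies p) *
              ((d : ℝ)⁻¹) ^ numValuesS (copies p))) := le_mul_of_one_le_right hR0 hone
            _ = _ := by ring
      · exact hnn
    · obtain ⟨⟨z, h0, -, hz⟩, -⟩ := h
      rw [← h0]; exact (hz 0).1.symm
  calc _ = ∑ p : Fin (q + 1) → α.Labelling n d × α.Labelling n d, ∑ A : α.RowIndex n d,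
        (if IsClosedWalk A p then
          ∫ x, ∏ z, α.term (copies p z) x ∂gaussianArray n d else 0) := by
        rw [Finset.sum_comm]
        refine Finset.sum_congr rfl fun A _ => ?_
        rw [integral_finsetSum _ fun p _ => by
          split_ifs
          · exact integrable_prod_term _
          · exact integrable_zero _ _ _]
        refine Finset.sum_congr rfl fun p _ => ?_
        split_ifs <;> simp
    _ ≤ ∑ p : Fin (q + 1) → α.Labelling n d × α.Labelling n d,
          R * (n : ℝ) ^ D * (((n : ℝ)⁻¹) ^ numValuesC (copies p) *
            ((d : ℝ)⁻¹) ^ numValuesS (copies p)) := Finset.sum_le_sum fun p _ => hterm p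
    -- All terms are nonnegative, so the sum may be extended to arbitrary families of labellings.
    _ ≤ ∑ ψ : Fin (q + 1) × Bool → α.Labelling n d,
          R * (n : ℝ) ^ D * (((n : ℝ)⁻¹) ^ numValuesC ψ * ((d : ℝ)⁻¹) ^ numValuesS ψ) := by
        have hf := Finset.sum_map Finset.univ ⟨_, copies_injective (α := α) (n := n) (d := d)
          (q := q + 1)⟩ (fun ψ => R * (n : ℝ) ^ D * (((n : ℝ)⁻¹) ^ numValuesC ψ *
            ((d : ℝ)⁻¹) ^ numValuesS ψ))
        exact hf.symm.le.trans (Finset.sum_le_sum_of_subset_of_nonneg (Finset.subset_univ _)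
          fun _ _ _ => by positivity)
    _ ≤ R * (n : ℝ) ^ D * (((n : ℝ) ^ (2 * (q + 1) * (α.activeC)ᶜ.card) *
        (2 * (q + 1) * α.activeC.card).factorial) *
      ((d : ℝ) ^ (2 * (q + 1) * (α.activeS)ᶜ.card) *
        (2 * (q + 1) * α.activeS.card).factorial)) := by
        rw [← Finset.mul_sum]
        have := sum_inv_pow_numValues_le (α := α) (n := n) (d := d) (T := Fin (q + 1) × Bool)
        rw [hcard] at this
        refine mul_le_mul_of_nonneg_left ?_ (by positivity)
        exact this
    _ = _ := by
        -- The exponent uses `φ(active) + 2 φ(Iso) = φ(V(α)) + φ(Iso)`; the separate factor `n` is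
        -- the `+ 1` in `D`.
        have hexp : (n : ℝ) ^ D * ((n : ℝ) ^ (2 * (q + 1) * (α.activeC)ᶜ.card) *
            (d : ℝ) ^ (2 * (q + 1) * (α.activeS)ᶜ.card)) =
            n * (n : ℝ) ^ ((q + 1) * (α.weight n d Finset.univ - α.weight n d S +
              α.weight n d α.iso)) := by
          have h1 : ∀ y : ℝ, (n : ℝ) * (n : ℝ) ^ y = (n : ℝ) ^ (1 + y) := fun y => by
            rw [Real.rpow_add hn0, Real.rpow_one]
          rw [h1, ← hlogb, ← Real.rpow_natCast, ← Real.rpow_add hn0, ← Real.rpow_add hn0,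
            weight_univ, weight_iso, hD]
          congr 1
          push_cast
          ring
        rw [← hexp]
        ring

end TraceMoment

/-! ### Markov's inequality -/

section Tail
variable {α : Shape} {n d : ℕ}

/-- Markov's inequality for the trace moment. -/
theorem measure_lt_matrixOpNorm_le (hα : α.IsProper) {q : ℕ} {b δ : ℝ} (hb : 0 < b)
    (h : ∫ x, ((α.graphMatrix (fun i k => x (i, k)) *
        (α.graphMatrix fun i k => x (i, k)).transpose) ^ (q + 1)).trace ∂gaussianArray n d ≤
      δ * b ^ (2 * (q + 1))) :
    gaussianArray n d {x | b < matrixOpNorm (α.graphMatrix fun i k => x (i, k))} ≤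
      ENNReal.ofReal δ := by
  classical
  have hle : ∀ x : Fin n × Fin d → ℝ, matrixOpNorm (α.graphMatrix fun i k => x (i, k)) ^
      (2 * (q + 1)) ≤ ((α.graphMatrix (fun i k => x (i, k)) *
        (α.graphMatrix fun i k => x (i, k)).transpose) ^ (q + 1)).trace :=
    fun x => matrixOpNorm_pow_le_trace _ _ (Nat.succ_ne_zero q)
  have hnn : ∀ x : Fin n × Fin d → ℝ, 0 ≤ ((α.graphMatrix (fun i k => x (i, k)) *
        (α.graphMatrix fun i k => x (i, k)).transpose) ^ (q + 1)).trace :=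
    fun x => le_trans (by rw [pow_mul]; positivity) (hle x)
  have hmarkov := mul_meas_ge_le_integral_of_nonneg (ae_of_all (gaussianArray n d) hnn)
    (integrable_trace_pow hα (q + 1)) (b ^ (2 * (q + 1)))
  have hsub : {x : Fin n × Fin d → ℝ |
      b < matrixOpNorm (α.graphMatrix fun i k => x (i, k))} ⊆ {x | b ^ (2 * (q + 1)) ≤
        ((α.graphMatrix (fun i k => x (i, k)) *
        (α.graphMatrix fun i k => x (i, k)).transpose) ^ (q + 1)).trace} := by
    intro x hx
    exact le_trans (pow_le_pow_left₀ hb.le (le_of_lt hx) _) (hle x)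
  refine (measure_mono hsub).trans ?_
  rw [← ENNReal.ofReal_toReal (measure_ne_top (gaussianArray n d) _)]
  refine ENNReal.ofReal_le_ofReal ?_
  have h2 := hmarkov.trans h
  rw [mul_comm δ] at h2
  exact le_of_mul_le_mul_left h2 (by positivity)

end Tail

/-! ### Shapes without edges: a deterministic bound -/

section Edgeless
variable {α : Shape} {n d : ℕ}

theorem card_embedding_extensions_le {l c n : ℕ} (ι : Fin l ↪ Fin c) (A : Fin l ↪ Fin n) :
    (Finset.univ.filter fun π : Fin c ↪ Fin n => ι.trans π = A).card ≤ n ^ (c - l) := by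
  classical
  have hcard : Fintype.card ({x : Fin c // x ∉ Set.range ι} → Fin n) = n ^ (c - l) := by
    rw [Fintype.card_fun, Fintype.card_fin, Fintype.card_subtype_compl, Fintype.card_fin]
    congr 2
    exact (Fintype.card_congr (Equiv.ofInjective ι ι.injective)).symm.trans (Fintype.card_fin l)
  rw [← hcard, ← Finset.card_univ]
  refine Finset.card_le_card_of_injOn (fun π x => π x.1) (by simp) ?_
  intro π hπ π' hπ' h
  simp only [Finset.coe_filter, Finset.mem_univ, true_and, Set.mem_ofPred_eq] at hπ hπ'
  refine DFunLike.ext _ _ fun x => ?_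
  by_cases hx : x ∈ Set.range ι
  · obtain ⟨i, rfl⟩ := hx
    exact (DFunLike.congr_fun hπ i).trans (DFunLike.congr_fun hπ' i).symm
  · exact congrFun h ⟨x, hx⟩

open Classical in
theorem card_row_eq_le (α : Shape) (A : α.RowIndex n d) :
    (Finset.univ.filter fun ψ : α.Labelling n d => α.row ψ = A).card ≤
      n ^ (α.circles - α.leftCircles) * d ^ (α.squares - α.leftSquares) := by
  have h : (Finset.univ.filter fun ψ : α.Labelling n d => α.row ψ = A) =
      (Finset.univ.filter fun π : Fin α.circles ↪ Fin n => α.leftC.trans π = A.1) ×ˢ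
      (Finset.univ.filter fun σ : Fin α.squares ↪ Fin d => α.leftS.trans σ = A.2) := by
    ext ψ
    simp [row, Prod.ext_iff]
  rw [h, Finset.card_product]
  refine Nat.mul_le_mul (le_trans (le_of_eq ?_) (card_embedding_extensions_le α.leftC A.1))
    (le_trans (le_of_eq ?_) (card_embedding_extensions_le α.leftS A.2)) <;> congr

open Classical in
theorem card_col_eq_le (α : Shape) (B : α.ColIndex n d) :
    (Finset.univ.filter fun ψ : α.Labelling n d => α.col ψ = B).card ≤
      n ^ (α.circles - α.rightCircles) * d ^ (α.squares - α.rightSquares) := by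
  have h : (Finset.univ.filter fun ψ : α.Labelling n d => α.col ψ = B) =
      (Finset.univ.filter fun π : Fin α.circles ↪ Fin n => α.rightC.trans π = B.1) ×ˢ
      (Finset.univ.filter fun σ : Fin α.squares ↪ Fin d => α.rightS.trans σ = B.2) := by
    ext ψ
    simp [col, Prod.ext_iff]
  rw [h, Finset.card_product]
  refine Nat.mul_le_mul (le_trans (le_of_eq ?_) (card_embedding_extensions_le α.rightC B.1))
    (le_trans (le_of_eq ?_) (card_embedding_extensions_le α.rightS B.2)) <;> congr

open Classical in
/-- `V_α` as a finite set. -/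
noncomputable def rightFinset (α : Shape) : Finset α.Vertex := {a | a ∈ α.rightSet}

theorem leftFinset_eq (α : Shape) :
    α.leftFinset = (Finset.univ.map α.leftC).disjSum (Finset.univ.map α.leftS) := by
  ext a
  rcases a with a | a <;> simp [leftFinset, leftSet]

theorem rightFinset_eq (α : Shape) :
    α.rightFinset = (Finset.univ.map α.rightC).disjSum (Finset.univ.map α.rightS) := by
  ext a
  rcases a with a | a <;> simp [rightFinset, rightSet]

theorem weight_leftFinset (α : Shape) : α.weight n d α.leftFinset =
    α.leftCircles + α.leftSquares * Real.logb n d := by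
  rw [leftFinset_eq]
  simp [weight, Finset.sum_disjSum, vertexWeight]

theorem weight_rightFinset (α : Shape) : α.weight n d α.rightFinset =
    α.rightCircles + α.rightSquares * Real.logb n d := by
  rw [rightFinset_eq]
  simp [weight, Finset.sum_disjSum, vertexWeight]

theorem weight_univ_eq (α : Shape) : α.weight n d Finset.univ =
    α.circles + α.squares * Real.logb n d := by
  simp [weight, vertexWeight]

theorem edgeLabel_eq_zero_of_totalLabel (hα : α.IsProper) (h0 : α.totalLabel = 0)
    (p : Fin α.circles × Fin α.squares) : α.edgeLabel p = 0 := by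
  rw [totalLabel_eq hα, Finset.sum_eq_zero_iff] at h0
  exact h0 p (Finset.mem_univ p)

/-- Without edges `U ∩ V` is a separator and the active vertices are `U ∪ V`; the claim follows from
additivity of the weight over union and intersection. -/
theorem weight_le_of_edgeless (hα : α.IsProper) (h0 : α.totalLabel = 0) {S : Finset α.Vertex}
    (hS : α.IsMinSeparator n d S) :
    α.weight n d Finset.univ + α.weight n d S ≤
      α.weight n d α.leftFinset + α.weight n d α.rightFinset + α.weight n d α.iso := by
  classical
  have hadj : ∀ a b, ¬ α.graph.Adj a b := by
    intro a b h
    obtain ⟨p, hp, -⟩ := (α.graph_adj_iff a b).1 h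
    exact hp (edgeLabel_eq_zero_of_totalLabel hα h0 p)
  have hsep : α.IsSeparator (α.leftFinset ∩ α.rightFinset) := by
    intro a ha b hb p _
    cases p with
    | nil => exact ⟨a, by simp, by simp [leftFinset, rightFinset, ha, hb]⟩
    | cons h _ => exact absurd h (hadj _ _)
  have hle := hS.2 _ hsep
  have hact : α.active = α.leftFinset ∪ α.rightFinset := by
    ext a
    simp [mem_active_iff, leftFinset, rightFinset, hadj]
  have hui : α.weight n d (α.leftFinset ∪ α.rightFinset) +
      α.weight n d (α.leftFinset ∩ α.rightFinset) =
      α.weight n d α.leftFinset + α.weight n d α.rightFinset :=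
    Finset.sum_union_inter
  rw [weight_univ, hact]
  linarith

/-- The entries count labellings. A row sum is at most `n ^ (φ(V(α)) - φ(U))`, a column sum likewise
with the right tuple, and the Schur test bounds the squared norm by their product. -/
theorem matrixOpNorm_le_of_edgeless (hα : α.IsProper) (h0 : α.totalLabel = 0) (hn : 2 ≤ n)
    (hd : 1 ≤ d) {S : Finset α.Vertex} (hS : α.IsMinSeparator n d S) (x : Fin n × Fin d → ℝ) :
    matrixOpNorm (α.graphMatrix fun i k => x (i, k)) ≤
      (n : ℝ) ^ ((α.weight n d Finset.univ - α.weight n d S + α.weight n d α.iso) / 2) := by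
  classical
  have hn0 : (0 : ℝ) < n := by positivity
  have hd0 : (0 : ℝ) < d := by positivity
  have hn1 : (1 : ℝ) < n := by exact_mod_cast hn
  have hterm : ∀ ψ : α.Labelling n d, α.term ψ x = 1 := fun ψ =>
    Finset.prod_eq_one fun p _ => by
      rw [edgeLabel_eq_zero_of_totalLabel hα h0, hermiteNormalized_zero]
  have hentry : ∀ A B, α.graphMatrix (fun i k => x (i, k)) A B =
      ∑ ψ : α.Labelling n d, if α.row ψ = A ∧ α.col ψ = B then 1 else 0 := by
    intro A B
    rw [graphMatrix_apply hα]
    simp only [hterm]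
  have hpow : ∀ i k : ℕ, (n : ℝ) ^ i * (d : ℝ) ^ k = (n : ℝ) ^ ((i : ℝ) + k * Real.logb n d) := by
    intro i k
    rw [Real.rpow_add hn0, Real.rpow_natCast, mul_comm (k : ℝ), Real.rpow_mul hn0.le,
      Real.rpow_logb hn0 hn1.ne' hd0, Real.rpow_natCast]
  have hsq := matrixOpNorm_sq_le_of_row_col (α.graphMatrix fun i k => x (i, k))
    (fun A B => by rw [hentry]; exact Finset.sum_nonneg fun _ _ => by split_ifs <;> norm_num)
    (R := (n : ℝ) ^ (α.circles - α.leftCircles) * (d : ℝ) ^ (α.squares - α.leftSquares))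
    (C := (n : ℝ) ^ (α.circles - α.rightCircles) * (d : ℝ) ^ (α.squares - α.rightSquares))
    (by positivity) (by positivity)
    (by
      intro A
      simp only [hentry]
      rw [Finset.sum_comm]
      refine le_trans (le_of_eq ?_) (Nat.cast_le.2 (card_row_eq_le α A)|>.trans (by push_cast; rfl))
      rw [Finset.card_filter, Nat.cast_sum]
      refine Finset.sum_congr rfl fun ψ _ => ?_
      rw [Finset.sum_eq_single (α.col ψ) (fun B _ hB => if_neg fun h => hB h.2.symm) (by simp)]
      simp)
    (by
      intro B
      simp only [hentry]
      rw [Finset.sum_comm]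
      refine le_trans (le_of_eq ?_) (Nat.cast_le.2 (card_col_eq_le α B)|>.trans (by push_cast; rfl))
      rw [Finset.card_filter, Nat.cast_sum]
      refine Finset.sum_congr rfl fun ψ _ => ?_
      rw [Finset.sum_eq_single (α.row ψ) (fun A _ hA => if_neg fun h => hA h.1.symm) (by simp)]
      simp)
  have hlc : α.leftCircles ≤ α.circles := by simpa using Fintype.card_le_of_embedding α.leftC
  have hls : α.leftSquares ≤ α.squares := by simpa using Fintype.card_le_of_embedding α.leftS
  have hrc : α.rightCircles ≤ α.circles := by simpa using Fintype.card_le_of_embedding α.rightC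
  have hrs : α.rightSquares ≤ α.squares := by simpa using Fintype.card_le_of_embedding α.rightS
  rw [hpow, hpow, ← Real.rpow_add hn0] at hsq
  have hexp : matrixOpNorm (α.graphMatrix fun i k => x (i, k)) ^ 2 ≤
      ((n : ℝ) ^ ((α.weight n d Finset.univ - α.weight n d S + α.weight n d α.iso) / 2)) ^ 2 := by
    refine hsq.trans ?_
    rw [← Real.rpow_mul_natCast hn0.le]
    refine Real.rpow_le_rpow_of_exponent_le hn1.le ?_
    have hw := weight_le_of_edgeless hα h0 hS
    rw [weight_leftFinset, weight_rightFinset] at hw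
    have hV := α.weight_univ_eq (n := n) (d := d)
    push_cast [hlc, hls, hrc, hrs]
    linarith
  exact le_of_sq_le_sq hexp (by positivity)

end Edgeless

/-! ### The number of active vertices -/

section ActiveCount
variable {α : Shape}

/-- An active vertex lies in a tuple or on an edge, and each edge has label at least `1`. With
tuples of length at most `1` and at least one edge this gives at most `4 * totalLabel` active
vertices, as the numerical estimate requires. -/
theorem card_active_le (hα : α.IsProper) :
    α.active.card ≤ α.leftSize + α.rightSize + 2 * α.totalLabel := by
  classical
  set E : Finset (Fin α.circles × Fin α.squares) := {p | α.edgeLabel p ≠ 0} with hE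
  have hEcard : E.card ≤ α.totalLabel := by
    rw [totalLabel_eq hα, Finset.card_eq_sum_ones]
    refine le_trans (Finset.sum_le_sum fun p hp => ?_)
      (Finset.sum_le_sum_of_subset (Finset.subset_univ E))
    exact Nat.one_le_iff_ne_zero.2 (by simpa [hE] using hp)
  have hsub : α.active ⊆ (α.leftFinset ∪ α.rightFinset) ∪
      (E.image (fun p => (Sum.inl p.1 : α.Vertex)) ∪ E.image fun p => (Sum.inr p.2 : α.Vertex)) := by
    intro a ha
    simp only [Finset.mem_union, Finset.mem_image]
    rcases (α.mem_active_iff a).1 ha with h | h | ⟨b, h⟩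
    · exact Or.inl (Or.inl (by simpa [leftFinset] using h))
    · exact Or.inl (Or.inr (by simpa [rightFinset] using h))
    · obtain ⟨p, hp, h | h⟩ := (α.graph_adj_iff a b).1 h
      · exact Or.inr (Or.inl ⟨p, by simpa [hE] using hp, h.1.symm⟩)
      · exact Or.inr (Or.inr ⟨p, by simpa [hE] using hp, h.2.symm⟩)
  have hl : α.leftFinset.card = α.leftSize := by simp [leftFinset_eq, leftSize]
  have hr : α.rightFinset.card = α.rightSize := by simp [rightFinset_eq, rightSize]
  have h1 := Finset.card_le_card hsub
  have h2 := Finset.card_union_le (α.leftFinset ∪ α.rightFinset)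
    (E.image (fun p => (Sum.inl p.1 : α.Vertex)) ∪ E.image fun p => (Sum.inr p.2 : α.Vertex))
  have h3 := Finset.card_union_le α.leftFinset α.rightFinset
  have h4 := Finset.card_union_le (E.image fun p => (Sum.inl p.1 : α.Vertex))
    (E.image fun p => (Sum.inr p.2 : α.Vertex))
  have h5 := Finset.card_image_le (s := E) (f := fun p => (Sum.inl p.1 : α.Vertex))
  have h6 := Finset.card_image_le (s := E) (f := fun p => (Sum.inr p.2 : α.Vertex))
  omega

theorem active_nonempty_of_totalLabel_ne_zero (hα : α.IsProper) (h : α.totalLabel ≠ 0) :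
    1 ≤ α.activeC.card ∧ 1 ≤ α.activeS.card := by
  rw [totalLabel_eq hα] at h
  obtain ⟨p, -, hp⟩ := Finset.exists_ne_zero_of_sum_ne_zero h
  have hadj : α.graph.Adj (Sum.inl p.1) (Sum.inr p.2) :=
    (α.graph_adj_iff _ _).2 ⟨p, hp, Or.inl ⟨rfl, rfl⟩⟩
  have h1 : (Sum.inl p.1 : α.Vertex) ∈ α.active :=
    (α.mem_active_iff _).2 (Or.inr (Or.inr ⟨_, hadj⟩))
  have h2 : (Sum.inr p.2 : α.Vertex) ∈ α.active :=
    (α.mem_active_iff _).2 (Or.inr (Or.inr ⟨_, hadj.symm⟩))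
  exact ⟨Finset.card_pos.2 ⟨p.1, by simpa [active] using h1⟩,
    Finset.card_pos.2 ⟨p.2, by simpa [active] using h2⟩⟩

theorem card_active (α : Shape) : α.active.card = α.activeC.card + α.activeS.card := by
  simp [active]

end ActiveCount

end Shape

/-! ### Numerical estimates -/

section Numerics

theorem factorial_mul_factorial_le {a b : ℕ} (ha : 2 ≤ a) (hb : 2 ≤ b) :
    a.factorial * b.factorial ≤ 2 * (a + b - 2).factorial := by
  induction a, ha using Nat.le_induction with
  | base => simp [Nat.factorial]
  | succ a ha ih =>
    have h : a + 1 + b - 2 = (a + b - 2) + 1 := by omega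
    rw [h, Nat.factorial_succ, Nat.factorial_succ, mul_assoc]
    calc (a + 1) * (a.factorial * b.factorial) ≤ (a + b - 2 + 1) * (2 * (a + b - 2).factorial) :=
          Nat.mul_le_mul (by omega) ih
      _ = _ := by ring

/-- With `K = k + 4` this reads `2 (K - 2)! ≤ (K / e) ^ K`: lowering the factorial by two absorbs
the square-root factor in Stirling's formula. The induction step rests on `(1 + 1 / K) ^ (K + 1) ≥
e`. -/
theorem two_mul_factorial_le (k : ℕ) :
    (2 * (k + 2).factorial : ℝ) ≤ Real.exp (((k : ℝ) + 4) * (Real.log (k + 4) - 1)) := by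
  induction k with
  | zero =>
    have h2 : Real.log 4 = 2 * Real.log 2 := by
      rw [show (4 : ℝ) = 2 ^ 2 by norm_num, Real.log_pow]; norm_num
    have h3 : Real.exp (8 * Real.log 2) = 2 ^ 8 := by
      rw [mul_comm, Real.exp_mul, Real.exp_log (by norm_num)]; norm_num
    have h4 : Real.exp 4 ≤ 64 := by
      have := Real.exp_one_lt_d9
      calc Real.exp 4 = Real.exp 1 ^ 4 := by rw [← Real.exp_nat_mul]; norm_num
        _ ≤ 2.75 ^ 4 := by gcongr; linarith
        _ ≤ 64 := by norm_num
    simp only [Nat.cast_zero, zero_add]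
    rw [h2, show (4 : ℝ) * (2 * Real.log 2 - 1) = 8 * Real.log 2 - 4 by ring, Real.exp_sub, h3,
      le_div_iff₀ (Real.exp_pos _)]
    norm_num [Nat.factorial]
    linarith
  | succ k ih =>
    have hk : (0 : ℝ) < (k : ℝ) + 4 := by positivity
    have hk5 : (0 : ℝ) < (k : ℝ) + 5 := by positivity
    have hlog : 1 ≤ ((k : ℝ) + 5) * (Real.log (k + 5) - Real.log (k + 4)) := by
      have h := Real.log_le_sub_one_of_pos (div_pos hk hk5)
      rw [Real.log_div hk.ne' hk5.ne'] at h
      have h2 : ((k : ℝ) + 5) * (((k : ℝ) + 4) / (k + 5) - 1) = -1 := by field_simp; ring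
      nlinarith
    have hstep : ((k : ℝ) + 3) * Real.exp (((k : ℝ) + 4) * (Real.log (k + 4) - 1)) ≤
        Real.exp (((k : ℝ) + 5) * (Real.log (k + 5) - 1)) := by
      calc _ ≤ Real.exp (Real.log (k + 4)) *
            Real.exp (((k : ℝ) + 4) * (Real.log (k + 4) - 1)) := by
            rw [Real.exp_log hk]; gcongr; linarith
        _ ≤ _ := by
            rw [← Real.exp_add]
            refine Real.exp_le_exp.2 ?_
            linarith
    rw [show k + 1 + 2 = (k + 2) + 1 by ring, Nat.factorial_succ]
    push_cast
    rw [show (k : ℝ) + 1 + 4 = k + 5 by ring]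
    calc _ = ((k : ℝ) + 3) * (2 * (k + 2).factorial) := by ring
      _ ≤ ((k : ℝ) + 3) * Real.exp (((k : ℝ) + 4) * (Real.log (k + 4) - 1)) := by gcongr
      _ ≤ _ := hstep

/-- The comparison of the trace moment with the norm bound. -/
theorem moment_numeric_bound {m c s E : ℕ} {L : ℝ} (hm : 2 ≤ m) (hc : 1 ≤ c) (hs : 1 ≤ s)
    (hE : c + s ≤ 4 * E) (hL : 6.9 ≤ L) (hK1 : L / 2 ≤ m * (c + s)) (hK2 : m * (c + s) ≤ L) :
    √((m : ℝ) - 1) ^ (m * E) * ((m * c).factorial * (m * s).factorial) * Real.exp L ≤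
      L ^ (m * (c + s + E)) := by
  have hL0 : 0 < L := by linarith
  have hcs : (2 : ℝ) ≤ (c : ℝ) + s := by
    have : 2 ≤ c + s := by omega
    exact_mod_cast this
  have hm0 : (2 : ℝ) ≤ m := by exact_mod_cast hm
  set K : ℝ := m * ((c : ℝ) + s) with hK
  have hK0 : 0 < K := by positivity
  -- There are at least two active vertices, so `m ≤ K / 2 ≤ L / 2`.
  have hmL : (m : ℝ) - 1 ≤ L / 2 := by nlinarith
  have hfact : (((m * c).factorial : ℝ) * (m * s).factorial) ≤ Real.exp (K * (Real.log K - 1)) := by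
    have h1 : 2 ≤ m * c := by nlinarith
    have h2 : 2 ≤ m * s := by nlinarith
    have h3 := factorial_mul_factorial_le h1 h2
    obtain ⟨k, hk⟩ : ∃ k, m * c + m * s = k + 4 := ⟨m * c + m * s - 4, by omega⟩
    have h4 := two_mul_factorial_le k
    rw [hk, show k + 4 - 2 = k + 2 by omega] at h3
    have hKk : (k : ℝ) + 4 = K := by
      rw [hK, mul_add]; exact_mod_cast hk.symm
    rw [hKk] at h4
    refine le_trans ?_ h4
    exact_mod_cast h3
  have hsqrt : √((m : ℝ) - 1) ^ (m * E) ≤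
      Real.exp ((m * E : ℕ) * ((Real.log L - Real.log 2) / 2)) := by
    rw [Real.exp_nat_mul]
    gcongr
    rw [Real.sqrt_le_left (Real.exp_pos _).le, ← Real.exp_nat_mul]
    rw [show ((2 : ℕ) : ℝ) * ((Real.log L - Real.log 2) / 2) = Real.log (L / 2) by
      rw [Real.log_div hL0.ne' (by norm_num)]; push_cast; ring, Real.exp_log (by positivity)]
    exact hmL
  have hpow : L ^ (m * (c + s + E)) = Real.exp ((K + (m * E : ℕ)) * Real.log L) := by
    rw [← Real.rpow_natCast, Real.rpow_def_of_pos hL0, mul_comm]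
    congr 2
    rw [hK]; push_cast; ring
  have hlog2 := Real.log_two_gt_d9
  have hlog2L : 2.46 ≤ Real.log 2 + Real.log L := by
    have h1 : (2 : ℝ) ^ 18 ≤ (2 * L) ^ 5 := by
      calc (2 : ℝ) ^ 18 ≤ 13.8 ^ 5 := by norm_num
        _ ≤ (2 * L) ^ 5 := by gcongr; linarith
    have h2 := Real.log_le_log (by positivity) h1
    rw [Real.log_pow, Real.log_pow, Real.log_mul (by norm_num) hL0.ne'] at h2
    norm_num at h2
    linarith
  -- The tangent bound `log y ≤ y - 1` at `y = 2 * K / L`.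
  have hlogK : Real.log K ≤ Real.log L - Real.log 2 + 2 * K / L - 1 := by
    have h := Real.log_le_sub_one_of_pos (show 0 < 2 * K / L by positivity)
    rw [Real.log_div (by positivity) hL0.ne', Real.log_mul (by norm_num) hK0.ne'] at h
    linarith
  have hN : K / 4 ≤ ((m * E : ℕ) : ℝ) := by
    have : ((c : ℝ) + s) ≤ 4 * E := by exact_mod_cast hE
    rw [hK]; push_cast; nlinarith
  -- Equivalent to `(K - L / 2) * (L - K) ≥ 0`; this is where both bounds on `K` are needed to
  -- absorb `exp L`.
  have hquad : L ≤ K * (3 - 2 * K / L) := by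
    have h : 0 ≤ (K - L / 2) * (L - K) := mul_nonneg (by linarith) (by linarith)
    have h2 : K * (3 - 2 * K / L) = (3 * K * L - 2 * K ^ 2) / L := by field_simp
    rw [h2, le_div_iff₀ hL0]
    nlinarith
  rw [hpow]
  calc _ ≤ Real.exp ((m * E : ℕ) * ((Real.log L - Real.log 2) / 2)) *
        Real.exp (K * (Real.log K - 1)) * Real.exp L := by gcongr
    _ = Real.exp ((m * E : ℕ) * ((Real.log L - Real.log 2) / 2) + K * (Real.log K - 1) + L) := by
        rw [Real.exp_add, Real.exp_add]
    _ ≤ _ := by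
        refine Real.exp_le_exp.2 ?_
        -- After `hlogK` and `hquad` it remains to beat `K * (1 - log 2) < 0.3069 * K`; half of this
        -- lower bound is `0.3075 * K`.
        have h1 : K / 4 * 2.46 ≤ ((m * E : ℕ) : ℝ) * (Real.log 2 + Real.log L) :=
          mul_le_mul hN hlog2L (by norm_num) (by positivity)
        have h2 : K * Real.log K ≤ K * (Real.log L - Real.log 2 + 2 * K / L - 1) :=
          mul_le_mul_of_nonneg_left hlogK hK0.le
        have h3 : K * 0.6931 ≤ K * Real.log 2 := mul_le_mul_of_nonneg_left (by linarith) hK0.le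
        nlinarith

end Numerics

namespace Shape

/-! ### Enumeration of proper shapes -/

section Enumeration

/-- The tuple of length `0` or `1` given by an optional vertex. -/
def optionTuple {c : ℕ} : Option (Fin c) → Σ l, Fin l ↪ Fin c
  | none => ⟨0, ⟨Fin.elim0, fun i => i.elim0⟩⟩
  | some a => ⟨1, ⟨fun _ => a, fun _ _ _ => Subsingleton.elim _ _⟩⟩

theorem exists_optionTuple {c s lc ls : ℕ} (fc : Fin lc ↪ Fin c) (fs : Fin ls ↪ Fin s)
    (h : lc + ls ≤ 1) : ∃ u : Option (Fin c ⊕ Fin s),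
      (⟨lc, fc⟩ : Σ l, Fin l ↪ Fin c) = optionTuple (u.bind Sum.getLeft?) ∧
      (⟨ls, fs⟩ : Σ l, Fin l ↪ Fin s) = optionTuple (u.bind Sum.getRight?) := by
  have h0 : ∀ {c : ℕ} (f : Fin 0 ↪ Fin c), (⟨0, f⟩ : Σ l, Fin l ↪ Fin c) = optionTuple none := by
    intro c f
    simp only [optionTuple, Sigma.mk.injEq, heq_eq_eq, true_and]
    ext i; exact i.elim0
  have h1 : ∀ {c : ℕ} (f : Fin 1 ↪ Fin c),
      (⟨1, f⟩ : Σ l, Fin l ↪ Fin c) = optionTuple (some (f 0)) := by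
    intro c f
    simp only [optionTuple, Sigma.mk.injEq, heq_eq_eq, true_and]
    ext i; rw [Subsingleton.elim i 0]; rfl
  rcases Nat.le_one_iff_eq_zero_or_eq_one.1 (show lc ≤ 1 by omega) with rfl | rfl
  · rcases Nat.le_one_iff_eq_zero_or_eq_one.1 (show ls ≤ 1 by omega) with rfl | rfl
    · exact ⟨none, h0 fc, h0 fs⟩
    · exact ⟨some (Sum.inr (fs 0)), h0 fc, h1 fs⟩
  · obtain rfl : ls = 0 := by omega
    exact ⟨some (Sum.inl (fc 0)), h1 fc, h0 fs⟩

/-- The shape with given tuples and edge labels. -/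
def ofLabels (c s : ℕ) (lc rc : Σ l, Fin l ↪ Fin c) (ls rs : Σ l, Fin l ↪ Fin s)
    (lab : Fin c × Fin s → ℕ) : Shape where
  circles := c
  squares := s
  leftCircles := lc.1
  leftSquares := ls.1
  rightCircles := rc.1
  rightSquares := rs.1
  leftC := lc.2
  leftS := ls.2
  rightC := rc.2
  rightS := rs.2
  edges := (Finset.univ.filter fun p => lab p ≠ 0).val.map fun p => (p.1, p.2, lab p)
  label_pos := by
    intro e he
    obtain ⟨p, hp, rfl⟩ := Multiset.mem_map.1 he
    exact Nat.one_le_iff_ne_zero.2 (Finset.mem_filter.1 hp).2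

theorem eq_ofLabels {α : Shape} (hα : α.IsProper) :
    α = ofLabels α.circles α.squares ⟨_, α.leftC⟩ ⟨_, α.rightC⟩ ⟨_, α.leftS⟩ ⟨_, α.rightS⟩
      α.edgeLabel := by
  have h : α.edges = (Finset.univ.filter fun p => α.edgeLabel p ≠ 0).val.map
      fun p => (p.1, p.2, α.edgeLabel p) := by
    rw [← map_endpoints_eq hα, Multiset.map_map]
    conv_lhs => rw [← Multiset.map_id' α.edges]
    exact Multiset.map_congr rfl fun e he => by simp [edgeLabel_of_mem hα he]
  obtain ⟨c, s, lc, ls, rc, rs, fc, fs, gc, gs, edges, hpos⟩ := α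
  simp only [ofLabels, mk.injEq, heq_eq_eq, true_and]
  exact h

/-- Labels are encoded as multiplicities in a multiset of size exactly `D`, padded with `none`. -/
theorem exists_sym_count {β : Type*} [Fintype β] [DecidableEq β] (lab : β → ℕ) {D : ℕ}
    (h : ∑ p, lab p ≤ D) :
    ∃ g : Sym (Option β) D, lab = fun p => (g : Multiset (Option β)).count (some p) := by
  refine ⟨⟨∑ p, Multiset.replicate (lab p) (some p) +
    Multiset.replicate (D - ∑ p, lab p) none, ?_⟩, ?_⟩
  · simp; omega
  · funext p
    simp [Multiset.count_sum', Multiset.count_replicate]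

/-- The data that determine a proper shape with `c` circles, `s` squares, tuples of length at most
`1` and total label at most `D`. -/
abbrev Code (D c s : ℕ) : Type :=
  Option (Fin c ⊕ Fin s) × Option (Fin c ⊕ Fin s) × Sym (Option (Fin c × Fin s)) D

/-- The shape given by a code. -/
def ofCode {D c s : ℕ} (z : Code D c s) : Shape :=
  ofLabels c s (optionTuple (z.1.bind Sum.getLeft?)) (optionTuple (z.2.1.bind Sum.getLeft?))
    (optionTuple (z.1.bind Sum.getRight?)) (optionTuple (z.2.1.bind Sum.getRight?))
    fun p => (z.2.2 : Multiset (Option (Fin c × Fin s))).count (some p)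

theorem exists_ofCode {α : Shape} (hα : α.IsProper) {D : ℕ} (hD : α.totalLabel ≤ D)
    (hl : α.leftSize ≤ 1) (hr : α.rightSize ≤ 1) :
    ∃ z : Code D α.circles α.squares, α = ofCode z := by
  obtain ⟨u, hu1, hu2⟩ := exists_optionTuple α.leftC α.leftS hl
  obtain ⟨v, hv1, hv2⟩ := exists_optionTuple α.rightC α.rightS hr
  obtain ⟨g, hg⟩ := exists_sym_count α.edgeLabel ((totalLabel_eq hα).symm.le.trans hD)
  refine ⟨(u, v, g), (eq_ofLabels hα).trans ?_⟩
  rw [ofCode, hu1, hu2, hv1, hv2, hg]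

theorem card_sym_le_pow {β : Type*} [Fintype β] [DecidableEq β] (D : ℕ) :
    Fintype.card (Sym β D) ≤ Fintype.card β ^ D := by
  rw [← card_vector]
  exact Fintype.card_le_of_surjective (Sym.ofVector (α := β) (n := D)) fun m =>
    ⟨⟨(m : Multiset β).toList, by simp⟩, Subtype.ext (Multiset.coe_toList _)⟩

theorem card_code_le (D c s : ℕ) :
    Fintype.card (Code D c s) ≤ (c + s + 1) ^ 2 * (c * s + 1) ^ D := by
  simp only [Fintype.card_prod, Fintype.card_option, Fintype.card_sum, Fintype.card_fin]
  have h := card_sym_le_pow (β := Option (Fin c × Fin s)) D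
  simp only [Fintype.card_option, Fintype.card_prod, Fintype.card_fin] at h
  rw [sq, mul_assoc (c + s + 1)]
  exact Nat.mul_le_mul le_rfl (Nat.mul_le_mul le_rfl h)

/-- The numbers of circles and squares of the shapes with at most `DV` vertices. -/
def sizes (DV : ℕ) : Finset (ℕ × ℕ) :=
  (Finset.range (DV + 1) ×ˢ Finset.range (DV + 1)).filter fun z => z.1 + z.2 ≤ DV

theorem succ_pow_four_le {D : ℕ} (hD : 2 ≤ D) : (D + 1) ^ 4 ≤ 11 * D ^ 2 * 2 ^ D := by
  induction D, hD using Nat.le_induction with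
  | base => norm_num
  | succ D hD ih =>
    have h1 : (D + 1 + 1) ^ 4 * D ^ 2 ≤ 2 * (D + 1) ^ 2 * (D + 1) ^ 4 := by
      ring_nf
      have h2 : 0 ≤ D ^ 3 ∧ 0 ≤ D ^ 4 ∧ 0 ≤ D ^ 5 ∧ 0 ≤ D ^ 6 := by simp
      omega
    have h2 : (D + 1 + 1) ^ 4 * D ^ 2 ≤ (11 * (D + 1) ^ 2 * 2 ^ (D + 1)) * D ^ 2 := by
      calc _ ≤ 2 * (D + 1) ^ 2 * (D + 1) ^ 4 := h1
        _ ≤ 2 * (D + 1) ^ 2 * (11 * D ^ 2 * 2 ^ D) := Nat.mul_le_mul le_rfl ih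
        _ = _ := by ring
    exact Nat.le_of_mul_le_mul_right h2 (by positivity)

theorem sum_card_code_le {DV DE : ℕ} (hDV : 2 ≤ DV) (hDE : DV ≤ DE) :
    ∑ z ∈ sizes DV, Fintype.card (Code DE z.1 z.2) ≤ 11 * DV ^ (2 * DE + 2) := by
  -- The factor `2 ^ DE` clears the denominator in `c * s + 1 ≤ DV ^ 2 / 2`, which holds because
  -- both `c * s` and `1` are at most `DV ^ 2 / 4`.
  have hterm : ∀ z ∈ sizes DV,
      2 ^ DE * Fintype.card (Code DE z.1 z.2) ≤ (DV + 1) ^ 2 * (DV ^ 2) ^ DE := by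
    intro z hz
    have hz' : z.1 + z.2 ≤ DV := (Finset.mem_filter.1 hz).2
    have h4 : 2 * (z.1 * z.2 + 1) ≤ DV ^ 2 := by
      have h5 : 4 * (z.1 * z.2) ≤ (z.1 + z.2) ^ 2 := by
        zify; nlinarith [sq_nonneg ((z.1 : ℤ) - z.2)]
      have h6 : (z.1 + z.2) ^ 2 ≤ DV ^ 2 := Nat.pow_le_pow_left hz' 2
      have h7 : 2 ^ 2 ≤ DV ^ 2 := Nat.pow_le_pow_left hDV 2
      omega
    calc _ ≤ 2 ^ DE * ((z.1 + z.2 + 1) ^ 2 * (z.1 * z.2 + 1) ^ DE) :=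
          Nat.mul_le_mul le_rfl (card_code_le _ _ _)
      _ = (z.1 + z.2 + 1) ^ 2 * (2 * (z.1 * z.2 + 1)) ^ DE := by rw [mul_pow]; ring
      _ ≤ _ := Nat.mul_le_mul (Nat.pow_le_pow_left (by omega) 2) (Nat.pow_le_pow_left h4 DE)
  have hcard : (sizes DV).card ≤ (DV + 1) ^ 2 := by
    refine (Finset.card_filter_le _ _).trans ?_
    simp [sq]
  have h1 : 2 ^ DE * ∑ z ∈ sizes DV, Fintype.card (Code DE z.1 z.2) ≤
      2 ^ DE * (11 * DV ^ (2 * DE + 2)) := by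
    rw [Finset.mul_sum]
    calc _ ≤ (sizes DV).card • ((DV + 1) ^ 2 * (DV ^ 2) ^ DE) :=
          Finset.sum_le_card_nsmul _ _ _ hterm
      _ ≤ (DV + 1) ^ 2 * ((DV + 1) ^ 2 * (DV ^ 2) ^ DE) := Nat.mul_le_mul hcard le_rfl
      _ = (DV + 1) ^ 4 * (DV ^ 2) ^ DE := by ring
      -- The gain `2 ^ DE ≥ 2 ^ DV` pays for the numbers of sizes and of tuples, up to `11 * DV ^
      -- 2`.
      _ ≤ (11 * DV ^ 2 * 2 ^ DE) * (DV ^ 2) ^ DE := by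
          refine Nat.mul_le_mul ((succ_pow_four_le hDV).trans ?_) le_rfl
          exact Nat.mul_le_mul le_rfl (Nat.pow_le_pow_right (by norm_num) hDE)
      _ = _ := by rw [← pow_mul, pow_add]; ring
  exact Nat.le_of_mul_le_mul_left h1 (by positivity)

end Enumeration

/-! ### Failure probability of one shape and the union bound -/

section UnionBound
variable {n d : ℕ}

/-- The bound on the operator norm of the graph matrix. -/
noncomputable def normBound (α : Shape) (n d : ℕ) (L : ℝ) (S : Finset α.Vertex) : ℝ :=
  L ^ (α.numVertices + α.totalLabel) *
    (n : ℝ) ^ ((α.weight n d Finset.univ - α.weight n d S + α.weight n d α.iso) / 2)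

theorem integral_trace_pow_le_normBound {α : Shape} (hα : α.IsProper) (hn : 2 ≤ n) (hd : 1 ≤ d)
    (hdn : d ≤ n) (hleft : α.leftSize ≤ 1) (hright : α.rightSize ≤ 1) (h0 : α.totalLabel ≠ 0)
    {S : Finset α.Vertex} (hS : α.IsMinSeparator n d S) {L : ℝ} (hL : 6.9 ≤ L) {q : ℕ}
    (hq1 : L / 2 ≤ (2 * (q + 1) : ℕ) * (α.active.card : ℝ))
    (hq2 : (2 * (q + 1) : ℕ) * (α.active.card : ℝ) ≤ L) :
    ∫ x, ((α.graphMatrix (fun i k => x (i, k)) *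
        (α.graphMatrix fun i k => x (i, k)).transpose) ^ (q + 1)).trace ∂gaussianArray n d ≤
      (n * Real.exp (-L)) * α.normBound n d L S ^ (2 * (q + 1)) := by
  have hn0 : (0 : ℝ) < n := by positivity
  obtain ⟨hc, hs⟩ := active_nonempty_of_totalLabel_ne_zero hα h0
  have hcard := card_active_le hα
  rw [card_active] at hq1 hq2 hcard
  push_cast at hq1 hq2
  have hnum := moment_numeric_bound (m := 2 * (q + 1)) (c := α.activeC.card) (s := α.activeS.card)
    (E := α.totalLabel) (L := L) (by omega) hc hs (by omega) hL
    (by push_cast; exact hq1) (by push_cast; exact hq2)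
  have hV : α.activeC.card + α.activeS.card ≤ α.numVertices := by
    have h1 := Finset.card_le_univ α.activeC
    have h2 := Finset.card_le_univ α.activeS
    simp only [Fintype.card_fin] at h1 h2
    exact Nat.add_le_add h1 h2
  set X : ℝ := α.weight n d Finset.univ - α.weight n d S + α.weight n d α.iso with hX
  refine (integral_trace_pow_le hα hn hd hdn hleft hS q).trans ?_
  have hb : α.normBound n d L S ^ (2 * (q + 1)) =
      L ^ (2 * (q + 1) * (α.numVertices + α.totalLabel)) * (n : ℝ) ^ ((q + 1) * X) := by
    rw [normBound, mul_pow, ← pow_mul, mul_comm _ (2 * (q + 1)), ← Real.rpow_mul_natCast hn0.le]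
    congr 2
    push_cast; ring
  have hmono : L ^ (2 * (q + 1) * (α.activeC.card + α.activeS.card + α.totalLabel)) ≤
      L ^ (2 * (q + 1) * (α.numVertices + α.totalLabel)) :=
    pow_le_pow_right₀ (by linarith) (Nat.mul_le_mul le_rfl (by omega))
  rw [hb, Real.exp_neg, ← div_eq_mul_inv]
  have hexp := Real.exp_pos L
  rw [div_mul_eq_mul_div, le_div_iff₀ hexp]
  have h2 := mul_le_mul_of_nonneg_left (hnum.trans hmono)
    (show 0 ≤ (n : ℝ) * (n : ℝ) ^ ((q + 1) * X) by positivity)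
  refine le_trans (le_of_eq ?_) (h2.trans (le_of_eq ?_)) <;> ring

theorem measure_normBound_lt_le {α : Shape} (hα : α.IsProper) (hn : 2 ≤ n) (hd : 1 ≤ d)
    (hdn : d ≤ n) (hleft : α.leftSize ≤ 1) (hright : α.rightSize ≤ 1) {L : ℝ} (hL : 6.9 ≤ L)
    (hV : 2 * (α.numVertices : ℝ) ≤ L) :
    gaussianArray n d {x | ∃ S : Finset α.Vertex, α.IsMinSeparator n d S ∧
      α.normBound n d L S < matrixOpNorm (α.graphMatrix fun i k => x (i, k))} ≤
      ENNReal.ofReal (n * Real.exp (-L)) := by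
  by_cases hex : ∃ S : Finset α.Vertex, α.IsMinSeparator n d S
  swap
  · refine le_trans (le_of_eq ?_) zero_le
    rw [show {x : Fin n × Fin d → ℝ | ∃ S : Finset α.Vertex, α.IsMinSeparator n d S ∧
      α.normBound n d L S < matrixOpNorm (α.graphMatrix fun i k => x (i, k))} = ∅ from
      Set.eq_empty_of_forall_notMem fun x ⟨S, hS, _⟩ => hex ⟨S, hS⟩, measure_empty]
  obtain ⟨S, hS⟩ := hex
  have hn0 : (0 : ℝ) < n := by positivity
  have hsub : {x : Fin n × Fin d → ℝ | ∃ S : Finset α.Vertex, α.IsMinSeparator n d S ∧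
      α.normBound n d L S < matrixOpNorm (α.graphMatrix fun i k => x (i, k))} ⊆
      {x | α.normBound n d L S < matrixOpNorm (α.graphMatrix fun i k => x (i, k))} := by
    rintro x ⟨S', hS', hlt⟩
    -- All minimum separators have the same weight, so one of them determines the bound.
    have hw : α.weight n d S' = α.weight n d S :=
      le_antisymm (hS'.2 S hS.1) (hS.2 S' hS'.1)
    simpa [normBound, hw] using hlt
  refine (measure_mono hsub).trans ?_
  by_cases h0 : α.totalLabel = 0
  · refine le_trans (le_of_eq ?_) zero_le
    rw [Set.eq_empty_of_forall_notMem (s := {x : Fin n × Fin d → ℝ |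
      α.normBound n d L S < matrixOpNorm (α.graphMatrix fun i k => x (i, k))}), measure_empty]
    intro x hx
    refine absurd (matrixOpNorm_le_of_edgeless hα h0 hn hd hS x) (not_le.2 (lt_of_le_of_lt ?_ hx))
    exact le_mul_of_one_le_left (by positivity) (one_le_pow₀ (by linarith))
  · have hb : 0 < α.normBound n d L S := by
      have : 0 < L := by linarith
      unfold normBound; positivity
    obtain ⟨hc, hs⟩ := active_nonempty_of_totalLabel_ne_zero hα h0
    have hw0 : (2 : ℝ) ≤ α.active.card := by
      rw [card_active]; exact_mod_cast (by omega)
    have hwV : (α.active.card : ℝ) ≤ α.numVertices := by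
      have h := Finset.card_le_univ α.active
      simp only [Fintype.card_sum, Fintype.card_fin] at h
      exact_mod_cast h
    have hw2 : 0 < 2 * (α.active.card : ℝ) := by linarith
    have hy1 : 1 ≤ L / (2 * (α.active.card : ℝ)) := by
      rw [le_div_iff₀ hw2]; linarith
    -- For `y ≥ 1` the floor of `y` lies between `y / 2` and `y`; with `y = L / (2 * |active|)` this
    -- places `2 * (q + 1) * |active|` between `L / 2` and `L`.
    obtain ⟨q, hq⟩ : ∃ q, ⌊L / (2 * (α.active.card : ℝ))⌋₊ = q + 1 :=
      Nat.exists_eq_succ_of_ne_zero (Nat.floor_pos.2 hy1).ne'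
    have hf1 := Nat.floor_le (show 0 ≤ L / (2 * (α.active.card : ℝ)) by linarith)
    have hf2 := Nat.lt_floor_add_one (L / (2 * (α.active.card : ℝ)))
    rw [hq, le_div_iff₀ hw2] at hf1
    rw [hq, div_lt_iff₀ hw2] at hf2
    push_cast at hf1 hf2
    refine measure_lt_matrixOpNorm_le hα hb
      (integral_trace_pow_le_normBound hα hn hd hdn hleft hright h0 hS hL (q := q) ?_ ?_)
    · push_cast
      nlinarith [mul_nonneg (Nat.cast_nonneg q : (0 : ℝ) ≤ q) hw2.le]
    · push_cast; linarith

/-- The union bound over all shapes. -/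
theorem measure_exists_shape_le (hn : 2 ≤ n) (hd : 1 ≤ d) (hdn : d ≤ n) {DV DE : ℕ}
    (hDV : 2 ≤ DV) (hDE : DV ≤ DE) {L : ℝ} (hL : 6.9 ≤ L) (hLV : 2 * (DV : ℝ) ≤ L) :
    gaussianArray n d {x | ∃ α : Shape, α.IsProper ∧ α.numVertices ≤ DV ∧ α.totalLabel ≤ DE ∧
      α.leftSize ≤ 1 ∧ α.rightSize ≤ 1 ∧ ∃ S : Finset α.Vertex, α.IsMinSeparator n d S ∧
        α.normBound n d L S < matrixOpNorm (α.graphMatrix fun i k => x (i, k))} ≤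
      ENNReal.ofReal ((11 * (DV : ℝ) ^ (2 * DE + 2)) * (n * Real.exp (-L))) := by
  -- The tail bound for one shape needs no bound on its total label; that bound only serves to
  -- produce a code.
  let bad : Shape → Set (Fin n × Fin d → ℝ) := fun α => {x | α.IsProper ∧ α.numVertices ≤ DV ∧
    α.leftSize ≤ 1 ∧ α.rightSize ≤ 1 ∧ ∃ S : Finset α.Vertex, α.IsMinSeparator n d S ∧
      α.normBound n d L S < matrixOpNorm (α.graphMatrix fun i k => x (i, k))}
  have hbad : ∀ α, gaussianArray n d (bad α) ≤ ENNReal.ofReal (n * Real.exp (-L)) := by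
    intro α
    by_cases h : α.IsProper ∧ α.numVertices ≤ DV ∧ α.leftSize ≤ 1 ∧ α.rightSize ≤ 1
    · refine (measure_mono fun x hx => hx.2.2.2.2).trans
        (measure_normBound_lt_le h.1 hn hd hdn h.2.2.1 h.2.2.2 hL (le_trans ?_ hLV))
      have : (α.numVertices : ℝ) ≤ DV := by exact_mod_cast h.2.1
      linarith
    · refine le_trans (le_of_eq ?_) zero_le
      rw [show bad α = ∅ from Set.eq_empty_of_forall_notMem fun x hx =>
        h ⟨hx.1, hx.2.1, hx.2.2.1, hx.2.2.2.1⟩, measure_empty]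
  have hcover : {x : Fin n × Fin d → ℝ | ∃ α : Shape, α.IsProper ∧ α.numVertices ≤ DV ∧
      α.totalLabel ≤ DE ∧ α.leftSize ≤ 1 ∧ α.rightSize ≤ 1 ∧ ∃ S : Finset α.Vertex,
      α.IsMinSeparator n d S ∧
        α.normBound n d L S < matrixOpNorm (α.graphMatrix fun i k => x (i, k))} ⊆
      ⋃ z ∈ sizes DV, ⋃ w : Code DE z.1 z.2, bad (ofCode w) := by
    rintro x ⟨α, h1, h2, h3, h4, h5, h6⟩
    obtain ⟨w, hw⟩ := exists_ofCode h1 h3 h4 h5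
    simp only [Set.mem_iUnion]
    refine ⟨(α.circles, α.squares), ?_, w, ?_⟩
    · have : α.circles + α.squares ≤ DV := h2
      simp only [sizes, Finset.mem_filter, Finset.mem_product, Finset.mem_range]
      omega
    · rw [← hw]
      exact ⟨h1, h2, h4, h5, h6⟩
  calc _ ≤ gaussianArray n d (⋃ z ∈ sizes DV, ⋃ w : Code DE z.1 z.2, bad (ofCode w)) :=
        measure_mono hcover
    _ ≤ ∑ z ∈ sizes DV, gaussianArray n d (⋃ w : Code DE z.1 z.2, bad (ofCode w)) :=
        measure_biUnion_finset_le _ _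
    _ ≤ ∑ z ∈ sizes DV, ∑ w : Code DE z.1 z.2, gaussianArray n d (bad (ofCode w)) :=
        Finset.sum_le_sum fun z _ => measure_iUnion_fintype_le _ _
    _ ≤ ∑ z ∈ sizes DV, ∑ _w : Code DE z.1 z.2, ENNReal.ofReal (n * Real.exp (-L)) :=
        Finset.sum_le_sum fun z _ => Finset.sum_le_sum fun w _ => hbad _
    _ = ((∑ z ∈ sizes DV, Fintype.card (Code DE z.1 z.2) : ℕ) : ENNReal) *
          ENNReal.ofReal (n * Real.exp (-L)) := by
        simp only [Finset.sum_const, Finset.card_univ, nsmul_eq_mul]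
        rw [← Finset.sum_mul, Nat.cast_sum]
    _ ≤ ((11 * DV ^ (2 * DE + 2) : ℕ) : ENNReal) * ENNReal.ofReal (n * Real.exp (-L)) := by
        gcongr
        exact sum_card_code_le hDV hDE
    _ = _ := by
        rw [← ENNReal.ofReal_natCast, ← ENNReal.ofReal_mul (by positivity)]
        push_cast
        rfl

end UnionBound

end Shape

/-! ### The main theorem -/

theorem mainTheorem1 {Ω : Type*} [MeasurableSpace Ω] (P : Measure Ω) [IsProbabilityMeasure P]
    (n d : ℕ) (hn : 2 ≤ n) (hd : 1 ≤ d) (hdn : d ≤ n)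
    (v : Fin n → Fin d → Ω → ℝ)
    (hlaw : ∀ i k, HasLaw (v i k) (gaussianReal 0 1) P)
    (hindep : iIndepFun (fun p : Fin n × Fin d => v p.1 p.2) P)
    (DV DE : ℕ) (hDV : 2 ≤ DV) (hDE : DV ≤ DE) (ε : ℝ) (hε : 0 < ε) :
    ENNReal.ofReal (1 - ε) ≤
      P {ω | ∀ α : Shape, α.IsProper → α.numVertices ≤ DV → α.totalLabel ≤ DE →
        α.leftSize ≤ 1 → α.rightSize ≤ 1 →
        ∀ S : Finset α.Vertex, α.IsMinSeparator n d S →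
          matrixOpNorm (α.graphMatrix fun i k => v i k ω) ≤
            ((2 * (DE : ℝ) + 2) * Real.log DV + Real.log (11 * n) + Real.log (1 / ε)) ^
                (α.numVertices + α.totalLabel) *
              (n : ℝ) ^ ((α.weight n d Finset.univ - α.weight n d S +
                α.weight n d α.iso) / 2)} := by
  -- For `ε ≥ 1` the claimed probability is nonpositive; below `1` the term `log (1 / ε)` is
  -- nonnegative.
  rcases le_or_gt 1 ε with h1 | h1
  · rw [ENNReal.ofReal_of_nonpos (by linarith)]; exact zero_le
  set L : ℝ := (2 * (DE : ℝ) + 2) * Real.log DV + Real.log (11 * n) + Real.log (1 / ε) with hLdef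
  have hn0 : (0 : ℝ) < n := by positivity
  have hn2 : (2 : ℝ) ≤ n := by exact_mod_cast hn
  have hDV2 : (2 : ℝ) ≤ DV := by exact_mod_cast hDV
  have hDE2 : (DV : ℝ) ≤ DE := by exact_mod_cast hDE
  have hDV0 : (0 : ℝ) < DV := by linarith
  have hlog2 := Real.log_two_gt_d9
  have hlogε : 0 ≤ Real.log (1 / ε) := Real.log_nonneg (by rw [le_div_iff₀ hε]; linarith)
  have hlogn : 4 * Real.log 2 ≤ Real.log (11 * n) := by
    rw [show 4 * Real.log 2 = Real.log (2 ^ 4) by rw [Real.log_pow]; norm_num]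
    exact Real.log_le_log (by norm_num) (by linarith)
  have hlogDV : Real.log 2 ≤ Real.log DV := Real.log_le_log (by norm_num) hDV2
  -- Since `2 * DE + 2 ≥ 6` and `11 * n ≥ 2 ^ 4`, one has `L ≥ 10 * log 2 > 6.9`.
  have hL : 6.9 ≤ L := by nlinarith
  have hLV : 2 * (DV : ℝ) ≤ L := by
    rcases hDV.eq_or_lt with h2 | h3
    · rw [← h2]; push_cast; linarith
    · have h4 : (3 : ℝ) ≤ DV := by exact_mod_cast h3
      have h5 : 1 ≤ Real.log DV := by
        rw [Real.le_log_iff_exp_le hDV0]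
        linarith [Real.exp_one_lt_d9]
      nlinarith
  have hexp : Real.exp L = (DV : ℝ) ^ (2 * DE + 2) * (11 * n) * (1 / ε) := by
    rw [hLdef, Real.exp_add, Real.exp_add, Real.exp_log (by positivity), Real.exp_log (by positivity),
      mul_comm _ (Real.log DV), Real.exp_mul, Real.exp_log hDV0, ← Real.rpow_natCast]
    push_cast; rfl
  have hmap : P.map (fun ω (p : Fin n × Fin d) => v p.1 p.2 ω) = Shape.gaussianArray n d := by
    rw [(iIndepFun_iff_map_fun_eq_pi_map fun p : Fin n × Fin d => (hlaw p.1 p.2).aemeasurable).1 hindep]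
    congr 1
    funext p
    exact (hlaw p.1 p.2).map_eq
  have haem : AEMeasurable (fun ω (p : Fin n × Fin d) => v p.1 p.2 ω) P :=
    aemeasurable_pi_iff.2 fun p => (hlaw p.1 p.2).aemeasurable
  have hunion := Shape.measure_exists_shape_le hn hd hdn hDV hDE hL hLV
  -- `L` is defined so that the union bound is exactly `ε`.
  have hε' : (11 * (DV : ℝ) ^ (2 * DE + 2)) * (n * Real.exp (-L)) = ε := by
    rw [Real.exp_neg, hexp]; field_simp
  rw [hε', ← hmap] at hunion
  set good : Set Ω := {ω | ∀ α : Shape, α.IsProper → α.numVertices ≤ DV → α.totalLabel ≤ DE →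
        α.leftSize ≤ 1 → α.rightSize ≤ 1 →
        ∀ S : Finset α.Vertex, α.IsMinSeparator n d S →
          matrixOpNorm (α.graphMatrix fun i k => v i k ω) ≤
            L ^ (α.numVertices + α.totalLabel) *
              (n : ℝ) ^ ((α.weight n d Finset.univ - α.weight n d S +
                α.weight n d α.iso) / 2)} with hgood
  have hbad : P goodᶜ ≤ ENNReal.ofReal ε := by
    refine le_trans (measure_mono ?_) ((Measure.le_map_apply haem _).trans hunion)
    intro ω hω
    simp only [hgood, Set.mem_compl_iff, Set.mem_ofPred_eq] at hω
    push Not at hω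
    exact hω.imp fun α h => h
  -- Subadditivity replaces the complement rule, so measurability of `good` is not needed.
  have hone : 1 ≤ P good + P goodᶜ := by
    rw [← measure_univ (μ := P), ← Set.union_compl_self good]
    exact measure_union_le _ _
  rw [ENNReal.ofReal_sub _ hε.le, ENNReal.ofReal_one]
  exact tsub_le_iff_right.2 (hone.trans (by gcongr))
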